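/- \textbf{Model.} Let $\mathcal L$ be a finite set, $\mu,\nu$ probability distributions on $\mathcal L$, and $a>b>0$. For $n\ge a$ the labeled stochastic block model is the random triple $(G,L,\sigma)$ on $n$ vertices in which the types $\sigma_u\in\{\pm1\}$ are independent and uniform and, given $\sigma$, independently for every pair $u<v$: if $\sigma_u=\sigma_v$, then $\{u,v\}$ is an edge with probability $a/n$, and its label is then drawn from $\mu$; if $\sigma_u\ne\sigma_v$, then $\{u,v\}$ is an edge with probability $b/n$, and its label is then drawn from $\nu$. For a weight function $w:\mathcal L\to[-1,1]$ put \[ \alpha=\tfrac12\sum_{\ell}w(\ell)\,(a\mu(\ell)+b\nu(\ell)),\qquad \beta=\tfrac12\sum_{\ell}w(\ell)\,(a\mu(\ell)-b\nu(\ell)), \] \[ \tau=\frac{a+b}{2}\sum_{\ell}\frac{a\mu(\ell)+b\nu(\ell)}{a+b}\Bigl(\frac{a\mu(\ell)-b\nu(\ell)}{a\mu(\ell)+b\nu(\ell)}\Bigr)^2, \] with the convention $0/0=0$. \textbf{Algorithm (Spectral-Reconstruction).} Remove from $G$ all edges incident to vertices of degree larger than $\frac32\cdot\frac{a+b}2$.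 Let $W'$ be the weighted adjacency matrix of the resulting graph ($W'_{uv}=w(L_{uv})$ if $\{u,v\}$ is an edge, and $0$ otherwise), let $J$ be the all-ones matrix and $D'=W'-\frac{\alpha}{n}J$. Let $\hat x$ be a maximizer of $|x^\top D'x|$ over $\|x\|=1$ (a singular vector of $D'$ for its largest singular value). Output $\hat\sigma=\mathrm{sign}(\hat x)\in\{\pm1\}^n$ (componentwise); the maximizer and the signs of its zero coordinates may be chosen arbitrarily. The output is called positively correlated with $\sigma$ asymptotically almost surely if there is a constant $\varepsilon>0$ independent of $n$ such that the probability that \[ Q(\sigma,\hat\sigma)=\frac12-\frac1n\min\{d(\sigma,\hat\sigma),\,d(\sigma,-\hat\sigma)\}\ \ge\ \varepsilon \] for every possible output $\hat\sigma$ of the algorithm tends to $1$ as $n\to\infty$; here $d$ is the Hamming distance. \textbf{Theorem.} There are universal constants $C_0,C>0$ (not depending on $a,b,\mathcal L,\mu,\nu,w$) such that for all fixed $a>b>C_0$, all finite $\mathcal L$, and all probability distributions $\mu,\nu$ on $\mathcal L$: \begin{enumerate} \item for every $w:\mathcal L\to[-1,1]$ with $\beta^2>C(a+b)$, the output of Spectral-Reconstruction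 with weight $w$ is asymptotically almost surely positively correlated with $\sigma$; \item for the weight $w(\ell)=\frac{a\mu(\ell)-b\nu(\ell)}{a\mu(\ell)+b\nu(\ell)}$ (with $0/0=0$), the condition $\beta^2>C(a+b)$ is equivalent to $\tau>\sqrt{C(a+b)}$; hence if $\tau>\sqrt{C(a+b)}$, the output of Spectral-Reconstruction with this weight is asymptotically almost surely positively correlated with $\sigma$. \end{enumerate} -/

import Mathlib

noncomputable section

namespace LabeledSBM

/-- Vertex pairs `(u, v)` with `u < v`. -/
abbrev VertexPair (n : ℕ) : Type := {p : Fin n × Fin n // p.1 < p.2}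

/-- A simple graph on `Fin n` together with an `L`-label on each edge: the pair `(u, v)`, `u < v`,
is sent to `none` if it is not an edge and to `some ℓ` if it is an edge with label `ℓ`. -/
abbrev LabeledGraph (n : ℕ) (L : Type) : Type := VertexPair n → Option L

/-- A type assignment: a vector in `{±1}ⁿ`. -/
abbrev TypeAssignment (n : ℕ) : Type := Fin n → ℤˣ

/-- The label of the unordered pair `{u, v}` (`none` if it is not an edge, in particular if
`u = v`). -/
def edgeLabel {n : ℕ} {L : Type} (X : LabeledGraph n L) (u v : Fin n) : Option L :=
  if h : u < v then X ⟨(u, v), h⟩ else if h : v < u then X ⟨(v, u), h⟩ else none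

theorem edgeLabel_comm {n : ℕ} {L : Type} (X : LabeledGraph n L) (u v : Fin n) :
    edgeLabel X u v = edgeLabel X v u := by
  rcases lt_trichotomy u v with h | h | h
  · simp [edgeLabel, h, h.not_gt]
  · simp [h]
  · simp [edgeLabel, h, h.not_gt]

/-- The underlying (unlabeled) graph. -/
def graph {n : ℕ} {L : Type} (X : LabeledGraph n L) : SimpleGraph (Fin n) where
  Adj u v := (edgeLabel X u v).isSome = true
  symm := ⟨fun u v h => by rw [edgeLabel_comm]; exact h⟩
  loopless := ⟨fun u h => by simp [edgeLabel] at h⟩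

instance {n : ℕ} {L : Type} (X : LabeledGraph n L) : DecidableRel (graph X).Adj :=
  fun u v => inferInstanceAs (Decidable ((edgeLabel X u v).isSome = true))

/-- The factor that one vertex pair contributes to the probability of a configuration:
`same` says whether the two types agree, and `o` is the state of the pair. -/
def pairMass {L : Type} (p q : ℝ) (μ ν : L → ℝ) (same : Prop) [Decidable same] :
    Option L → ℝ
  | some ℓ => if same then p * μ ℓ else q * ν ℓ
  | none => if same then 1 - p else 1 - q

/-- The probability `2⁻ⁿ ∏_{u < v} φ_{uv}` of the configuration `(σ, X)` in the labeled stochastic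
block model with parameters `n, p, q, μ, ν`. -/
def mass {n : ℕ} {L : Type} (p q : ℝ) (μ ν : L → ℝ)
    (ω : TypeAssignment n × LabeledGraph n L) : ℝ :=
  (2 : ℝ)⁻¹ ^ n * ∏ e : VertexPair n, pairMass p q μ ν (ω.1 e.1.1 = ω.1 e.1.2) (ω.2 e)

/-- The probability of the event `E` in the labeled stochastic block model with
parameters `n, p, q, μ, ν`. -/
def prob {n : ℕ} {L : Type} [Fintype L] (p q : ℝ) (μ ν : L → ℝ)
    (E : Set (TypeAssignment n × LabeledGraph n L)) : ℝ :=
  ∑ ω, E.indicator (mass p q μ ν) ω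

/-- Remove all edges incident to vertices whose degree is larger than `t`. -/
def prune {n : ℕ} {L : Type} (t : ℝ) (X : LabeledGraph n L) : LabeledGraph n L := fun e =>
  open Classical in
  if t < ((graph X).degree e.1.1 : ℝ) ∨ t < ((graph X).degree e.1.2 : ℝ) then none else X e

/-- The weighted adjacency matrix: `w ℓ` at an edge with label `ℓ`, and `0` at a non-edge. -/
def weightMatrix {n : ℕ} {L : Type} (w : L → ℝ) (X : LabeledGraph n L) :
    Matrix (Fin n) (Fin n) ℝ :=
  Matrix.of fun u v => (edgeLabel X u v).elim 0 w

def alpha {L : Type} [Fintype L] (a b : ℝ) (μ ν w : L → ℝ) : ℝ :=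
  1 / 2 * ∑ ℓ, w ℓ * (a * μ ℓ + b * ν ℓ)

def beta {L : Type} [Fintype L] (a b : ℝ) (μ ν w : L → ℝ) : ℝ :=
  1 / 2 * ∑ ℓ, w ℓ * (a * μ ℓ - b * ν ℓ)

def tau {L : Type} [Fintype L] (a b : ℝ) (μ ν : L → ℝ) : ℝ :=
  (a + b) / 2 * ∑ ℓ, (a * μ ℓ + b * ν ℓ) / (a + b) *
    ((a * μ ℓ - b * ν ℓ) / (a * μ ℓ + b * ν ℓ)) ^ 2

/-- The optimal weight function (equal to `0` at a label that never occurs). -/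
def optWeight {L : Type} (a b : ℝ) (μ ν : L → ℝ) (ℓ : L) : ℝ :=
  (a * μ ℓ - b * ν ℓ) / (a * μ ℓ + b * ν ℓ)

/-- The matrix `D' = W' - (α / n) J`, where `W'` is the weighted adjacency matrix after the removal
of all edges incident to vertices of degree larger than `(3 / 2) * ((a + b) / 2)`. -/
def centeredMatrix {n : ℕ} {L : Type} [Fintype L] (a b : ℝ) (μ ν w : L → ℝ)
    (X : LabeledGraph n L) : Matrix (Fin n) (Fin n) ℝ :=
  weightMatrix w (prune (3 / 2 * ((a + b) / 2)) X) -
    (alpha a b μ ν w / (n : ℝ)) • Matrix.of (fun _ _ => (1 : ℝ))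

/-- `x` maximizes `|xᵀ D x|` over the Euclidean unit sphere. -/
def IsTopVector {n : ℕ} (D : Matrix (Fin n) (Fin n) ℝ) (x : EuclideanSpace ℝ (Fin n)) : Prop :=
  ‖x‖ = 1 ∧ ∀ y : EuclideanSpace ℝ (Fin n), ‖y‖ = 1 →
    |y.ofLp ⬝ᵥ D.mulVec y.ofLp| ≤ |x.ofLp ⬝ᵥ D.mulVec x.ofLp|

/-- `s` is a componentwise sign of `x`; where `x` vanishes the sign may be either of `±1`. -/
def IsSignVector {n : ℕ} (x : EuclideanSpace ℝ (Fin n)) (s : TypeAssignment n) : Prop :=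
  ∀ u, (0 < x u → s u = 1) ∧ (x u < 0 → s u = -1)

/-- `s` is a possible output of the spectral algorithm on the labeled graph `X`, for some choice of
the maximizer and of the signs of its zero coordinates. -/
def IsSpectralOutput {n : ℕ} {L : Type} [Fintype L] (a b : ℝ) (μ ν w : L → ℝ)
    (X : LabeledGraph n L) (s : TypeAssignment n) : Prop :=
  ∃ x : EuclideanSpace ℝ (Fin n), IsTopVector (centeredMatrix a b μ ν w X) x ∧ IsSignVector x s

/-- The overlap `Q(σ, s) = 1/2 - (1/n) min {d(σ, s), d(σ, -s)}`, with `d` the Hamming distance. -/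
def overlap {n : ℕ} (σ s : TypeAssignment n) : ℝ :=
  1 / 2 - 1 / (n : ℝ) * min (hammingDist σ s : ℝ) (hammingDist σ (-s) : ℝ)

/-- With `p = a / n` and `q = b / n`, asymptotically almost surely every output of the spectral
algorithm is positively correlated with the true types: the overlap is at least a positive constant
that does not depend on `n`. -/
def SpectralSucceeds {L : Type} [Fintype L] (a b : ℝ) (μ ν w : L → ℝ) : Prop :=
  ∃ ε : ℝ, 0 < ε ∧ Filter.Tendsto
    (fun n : ℕ => prob (n := n) (a / (n : ℝ)) (b / (n : ℝ)) μ ν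
      {ω | ∀ s, IsSpectralOutput a b μ ν w ω.2 s → ε ≤ overlap ω.1 s})
    Filter.atTop (nhds 1)

end LabeledSBM

end

/-! Put d = (a+b)/2 and condition on σ. Up to its diagonal, the weight matrix before pruning has
mean (αJ + βσσᵀ)/n, so after subtracting (α/n)J only βσσᵀ/n remains, a rank-one matrix with singular
value |β| and direction σ/√n. If the noise has quadratic form at most E = O(√d) on the unit sphere,
comparing a maximizer with σ/√n shows that it is nearly parallel to σ as soon as |β| is a large
multiple of E (`abs_mul_one_sub_le_of_isTopVector`). Cauchy–Schwarz then turns a large inner product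
into agreement of signs (`overlap_ge_of_isSignVector`).

The work is the noise bound `abs_quadForm_deviationMatrix_le`, which follows Kahn–Szemerédi and
Feige–Ofek. It suffices to control the form at lattice points of the unit ball. There the pairs are
split according to the size of n|y_u y_v| relative to r, a power of two comparable to √d. Light
pairs have small coefficients, so an exponential moment bound beats the number of lattice points
(`prob_not_lightBound_le`). For heavy pairs only edge counts matter: these obey a discrepancy
property uniformly over all pairs of vertex sets (`prob_not_discrepancy_le`), and together with
bounded degrees a dyadic decomposition gives O(r) (`heavy_sum_le`).

Pruning provides the degree bound and deletes at most O(n/d) vertices (`prob_highDegree_le`), which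
changes the mean part by O(r) as well (`abs_quadForm_centeredMatrix_sub_le`). For the optimal
weight, β equals τ (`beta_optWeight`), so the second claim is a special case of the first. -/

noncomputable section

namespace LabeledSBM

open Finset

/-! ### Conditional independence of the pairs and exponential moments. -/

section Probability

variable {n : ℕ} {L : Type}

/-- The parameters are such that `mass` is a probability mass function. -/
structure Admissible [Fintype L] (p q : ℝ) (μ ν : L → ℝ) : Prop where
  p_nonneg : 0 ≤ p
  p_le_one : p ≤ 1
  q_nonneg : 0 ≤ q
  q_le_one : q ≤ 1
  μ_mem : μ ∈ stdSimplex ℝ L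
  ν_mem : ν ∈ stdSimplex ℝ L

/-- The probability that a pair of vertices is an edge. -/
def edgeProb (p q : ℝ) (same : Prop) [Decidable same] : ℝ := if same then p else q

/-- The indicator that a pair is an edge. -/
def edgeInd (o : Option L) : ℝ := o.elim 0 fun _ => 1

/-- The weight of a pair; non-edges have weight zero. -/
def pairWeight (w : L → ℝ) (o : Option L) : ℝ := o.elim 0 w

theorem edgeInd_nonneg (o : Option L) : 0 ≤ edgeInd o := by
  cases o <;> simp [edgeInd]

variable [Fintype L] {p q : ℝ} {μ ν : L → ℝ}

theorem pairMass_nonneg (H : Admissible p q μ ν) (same : Prop) [Decidable same] (o : Option L) :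
    0 ≤ pairMass p q μ ν same o := by
  have h1 := H.p_nonneg
  have h2 := H.p_le_one
  have h3 := H.q_nonneg
  have h4 := H.q_le_one
  cases o with
  | none => simp only [pairMass]; split_ifs <;> linarith
  | some ℓ =>
    simp only [pairMass]
    split_ifs
    · exact mul_nonneg h1 (H.μ_mem.1 ℓ)
    · exact mul_nonneg h3 (H.ν_mem.1 ℓ)

theorem sum_pairMass (H : Admissible p q μ ν) (same : Prop) [Decidable same] :
    ∑ o, pairMass p q μ ν same o = 1 := by
  rw [Fintype.sum_option]
  simp only [pairMass]
  split_ifs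
  · rw [← mul_sum, H.μ_mem.2]; ring
  · rw [← mul_sum, H.ν_mem.2]; ring

theorem mass_nonneg (H : Admissible p q μ ν) (ω : TypeAssignment n × LabeledGraph n L) :
    0 ≤ mass p q μ ν ω :=
  mul_nonneg (by positivity) (prod_nonneg fun _ _ => pairMass_nonneg H _ _)

/-- Given the types, the pairs are independent, so the expectation of a product over pairs
factorizes. -/
theorem sum_mass_mul_prod (p q : ℝ) (μ ν : L → ℝ)
    (F : TypeAssignment n → VertexPair n → Option L → ℝ) (c : TypeAssignment n → ℝ) :
    ∑ ω : TypeAssignment n × LabeledGraph n L,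
        mass p q μ ν ω * (c ω.1 * ∏ e, F ω.1 e (ω.2 e)) =
      (2 : ℝ)⁻¹ ^ n * ∑ σ : TypeAssignment n, c σ * ∏ e : VertexPair n,
        ∑ o, pairMass p q μ ν (σ e.1.1 = σ e.1.2) o * F σ e o := by
  rw [Fintype.sum_prod_type, mul_sum]
  refine sum_congr rfl fun σ _ => ?_
  rw [Fintype.prod_sum, mul_sum, mul_sum]
  refine sum_congr rfl fun X _ => ?_
  rw [mass, prod_mul_distrib]
  ring

theorem sum_mass_mul (H : Admissible p q μ ν) (c : TypeAssignment n → ℝ) :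
    ∑ ω : TypeAssignment n × LabeledGraph n L, mass p q μ ν ω * c ω.1 =
      (2 : ℝ)⁻¹ ^ n * ∑ σ : TypeAssignment n, c σ := by
  have := sum_mass_mul_prod p q μ ν (fun _ _ _ => (1 : ℝ)) c
  simpa [sum_pairMass H] using this

theorem inv_two_pow_mul_card : (2 : ℝ)⁻¹ ^ n * (Fintype.card (TypeAssignment n) : ℝ) = 1 := by
  rw [Fintype.card_fun]
  simp

theorem prob_mono (H : Admissible p q μ ν) {E F : Set (TypeAssignment n × LabeledGraph n L)}
    (h : E ⊆ F) : prob p q μ ν E ≤ prob p q μ ν F :=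
  sum_le_sum fun ω _ => Set.indicator_le_indicator_of_subset h (fun ω => mass_nonneg H ω) ω

theorem prob_univ (H : Admissible p q μ ν) :
    prob p q μ ν (Set.univ : Set (TypeAssignment n × LabeledGraph n L)) = 1 := by
  have := sum_mass_mul (n := n) H fun _ => 1
  rw [prob, Set.indicator_univ]
  simpa [inv_two_pow_mul_card] using this

theorem prob_add_prob_compl (H : Admissible p q μ ν)
    (E : Set (TypeAssignment n × LabeledGraph n L)) :
    prob p q μ ν E + prob p q μ ν Eᶜ = 1 := by
  rw [← prob_univ (n := n) H, prob, prob, prob, ← sum_add_distrib, Set.indicator_univ]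
  exact sum_congr rfl fun ω _ => congrFun (Set.indicator_self_add_compl E _) ω

theorem prob_union_le (H : Admissible p q μ ν) (E F : Set (TypeAssignment n × LabeledGraph n L)) :
    prob p q μ ν (E ∪ F) ≤ prob p q μ ν E + prob p q μ ν F := by
  rw [prob, prob, prob, ← sum_add_distrib]
  refine sum_le_sum fun ω _ => ?_
  have := mass_nonneg H ω
  by_cases h1 : ω ∈ E <;> by_cases h2 : ω ∈ F <;> simp [h1, h2, this]

theorem prob_biUnion_le (H : Admissible p q μ ν) {ι : Type*} (I : Finset ι)
    (E : ι → Set (TypeAssignment n × LabeledGraph n L)) :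
    prob p q μ ν {ω | ∃ i ∈ I, ω ∈ E i} ≤ ∑ i ∈ I, prob p q μ ν (E i) := by
  classical
  induction I using Finset.induction_on with
  | empty => simp [prob]
  | insert i I hi ih =>
    rw [sum_insert hi]
    refine le_trans (prob_mono H ?_) ((prob_union_le H (E i) {ω | ∃ i ∈ I, ω ∈ E i}).trans
      (by linarith))
    rintro ω ⟨j, hj, hω⟩
    rcases mem_insert.1 hj with rfl | hj
    · exact Or.inl hω
    · exact Or.inr ⟨j, hj, hω⟩

/-- The exponential Markov inequality for sums of independent contributions of the pairs. -/
theorem prob_lt_sum_le_exp (H : Admissible p q μ ν) (A : Set (TypeAssignment n))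
    (f : TypeAssignment n → VertexPair n → Option L → ℝ) (g : TypeAssignment n → VertexPair n → ℝ)
    (s : ℝ)
    (hf : ∀ σ ∈ A, ∀ e : VertexPair n,
      ∑ o, pairMass p q μ ν (σ e.1.1 = σ e.1.2) o * Real.exp (f σ e o) ≤ Real.exp (g σ e)) :
    prob p q μ ν {ω : TypeAssignment n × LabeledGraph n L |
      ω.1 ∈ A ∧ s < ∑ e, f ω.1 e (ω.2 e) - ∑ e, g ω.1 e} ≤ Real.exp (-s) := by
  classical
  -- The function of σ carries both the factor exp(-s) and the restriction to `A`, since the moment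
  -- bound is available only there.
  have key := sum_mass_mul_prod p q μ ν (fun σ e o => Real.exp (f σ e o - g σ e))
    (fun σ => if σ ∈ A then Real.exp (-s) else 0)
  calc prob p q μ ν {ω : TypeAssignment n × LabeledGraph n L |
      ω.1 ∈ A ∧ s < ∑ e, f ω.1 e (ω.2 e) - ∑ e, g ω.1 e}
      ≤ ∑ ω : TypeAssignment n × LabeledGraph n L, mass p q μ ν ω *
        ((if ω.1 ∈ A then Real.exp (-s) else 0) *
          ∏ e, Real.exp (f ω.1 e (ω.2 e) - g ω.1 e)) := by
        refine sum_le_sum fun ω _ => ?_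
        have h0 := mass_nonneg H ω
        by_cases h : ω.1 ∈ A ∧ s < ∑ e, f ω.1 e (ω.2 e) - ∑ e, g ω.1 e
        · rw [Set.indicator_of_mem (by exact h), if_pos h.1, ← Real.exp_sum, ← Real.exp_add]
          refine le_mul_of_one_le_right h0 (Real.one_le_exp ?_)
          rw [sum_sub_distrib]
          linarith [h.2]
        · rw [Set.indicator_of_notMem (by exact h)]
          refine mul_nonneg h0 (mul_nonneg ?_ (prod_nonneg fun _ _ => (Real.exp_pos _).le))
          split_ifs
          · exact (Real.exp_pos _).le
          · exact le_rfl
    _ ≤ (2 : ℝ)⁻¹ ^ n * ∑ σ : TypeAssignment n, Real.exp (-s) := by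
        rw [key]
        refine mul_le_mul_of_nonneg_left (sum_le_sum fun σ _ => ?_) (by positivity)
        split_ifs with hσ
        · refine mul_le_of_le_one_right (Real.exp_pos _).le (prod_le_one
            (fun e _ => sum_nonneg fun o _ =>
              mul_nonneg (pairMass_nonneg H _ _) (Real.exp_pos _).le) fun e _ => ?_)
          have := hf σ hσ e
          simp only [Real.exp_sub, mul_div_assoc']
          rw [← sum_div]
          exact (div_le_one (Real.exp_pos _)).2 this
        · simp [(Real.exp_pos _).le]
    _ = Real.exp (-s) := by
        rw [sum_const, nsmul_eq_mul, ← mul_assoc, card_univ, inv_two_pow_mul_card, one_mul]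

theorem sum_pairMass_mul_edgeInd (H : Admissible p q μ ν) (same : Prop) [Decidable same] :
    ∑ o, pairMass p q μ ν same o * edgeInd o = edgeProb p q same := by
  rw [Fintype.sum_option]
  simp only [pairMass, edgeInd, edgeProb, Option.elim]
  split_ifs
  · simp [← mul_sum, H.μ_mem.2]
  · simp [← mul_sum, H.ν_mem.2]

theorem sum_pairMass_mul_exp_edgeInd_le (H : Admissible p q μ ν) (same : Prop) [Decidable same]
    (c : ℝ) :
    ∑ o, pairMass p q μ ν same o * Real.exp (c * edgeInd o) ≤
      Real.exp (edgeProb p q same * (Real.exp c - 1)) := by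
  have h : ∀ o : Option L, Real.exp (c * edgeInd o) = 1 + edgeInd o * (Real.exp c - 1) := by
    intro o
    cases o <;> simp [edgeInd]
  simp only [h, mul_add, mul_one, sum_add_distrib, sum_pairMass H, ← mul_assoc, ← sum_mul,
    sum_pairMass_mul_edgeInd H]
  linarith [Real.add_one_le_exp (edgeProb p q same * (Real.exp c - 1))]

/-- Uses exp x ≤ 1 + x + x² for |x| ≤ 1. A weight is nonzero only on an edge and bounded by 1, so
its second moment is at most the edge probability. -/
theorem sum_pairMass_mul_exp_pairWeight_le (H : Admissible p q μ ν) (same : Prop)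
    [Decidable same] {w : L → ℝ} (hw : ∀ ℓ, |w ℓ| ≤ 1) {c : ℝ} (hc : |c| ≤ 1) :
    ∑ o, pairMass p q μ ν same o * Real.exp (c * pairWeight w o) ≤
      Real.exp (c * ∑ o, pairMass p q μ ν same o * pairWeight w o +
        c ^ 2 * edgeProb p q same) := by
  have h : ∀ o : Option L, Real.exp (c * pairWeight w o) ≤
      1 + c * pairWeight w o + c ^ 2 * edgeInd o := by
    intro o
    cases o with
    | none => simp [pairWeight, edgeInd]
    | some ℓ =>
      simp only [pairWeight, edgeInd, Option.elim, mul_one]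
      have h1 : |c * w ℓ| ≤ 1 := by
        rw [abs_mul]; exact mul_le_one₀ hc (abs_nonneg _) (hw ℓ)
      have h2 := (abs_le.1 (Real.abs_exp_sub_one_sub_id_le h1)).2
      have h3 : w ℓ ^ 2 ≤ 1 := (sq_le_one_iff_abs_le_one _).2 (hw ℓ)
      nlinarith [sq_nonneg c]
  calc ∑ o, pairMass p q μ ν same o * Real.exp (c * pairWeight w o)
      ≤ ∑ o, (pairMass p q μ ν same o + c * (pairMass p q μ ν same o * pairWeight w o) +
          c ^ 2 * (pairMass p q μ ν same o * edgeInd o)) := by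
        refine sum_le_sum fun o _ => ?_
        have := mul_le_mul_of_nonneg_left (h o) (pairMass_nonneg H same o)
        linarith
    _ = c * ∑ o, pairMass p q μ ν same o * pairWeight w o + c ^ 2 * edgeProb p q same + 1 := by
        rw [sum_add_distrib, sum_add_distrib, ← mul_sum, ← mul_sum, sum_pairMass H,
          sum_pairMass_mul_edgeInd H]
        ring
    _ ≤ _ := Real.add_one_le_exp _

theorem sum_pairMass_mul_pairWeight (p q : ℝ) (μ ν w : L → ℝ) (same : Prop) [Decidable same] :
    ∑ o, pairMass p q μ ν same o * pairWeight w o =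
      if same then p * ∑ ℓ, w ℓ * μ ℓ else q * ∑ ℓ, w ℓ * ν ℓ := by
  rw [Fintype.sum_option]
  simp only [pairMass, pairWeight, Option.elim]
  split_ifs <;> rw [mul_sum, mul_zero, zero_add] <;> exact sum_congr rfl fun _ _ => by ring

end Probability

/-- A double sum over all vertices, split into pairs and the diagonal. -/
theorem sum_sum_eq_sum_vertexPair {n : ℕ} (F : Fin n → Fin n → ℝ) :
    ∑ u, ∑ v, F u v =
      ∑ e : VertexPair n, (F e.1.1 e.1.2 + F e.1.2 e.1.1) + ∑ u, F u u := by
  have h1 : ∑ e : VertexPair n, F e.1.1 e.1.2 =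
      ∑ x : Fin n × Fin n, if x.1 < x.2 then F x.1 x.2 else 0 := by
    rw [← sum_filter]
    exact (sum_subtype (univ.filter fun x : Fin n × Fin n => x.1 < x.2) (by simp)
      fun x => F x.1 x.2).symm
  have h2 : ∑ e : VertexPair n, F e.1.2 e.1.1 =
      ∑ x : Fin n × Fin n, if x.1 < x.2 then F x.2 x.1 else 0 := by
    rw [← sum_filter]
    exact (sum_subtype (univ.filter fun x : Fin n × Fin n => x.1 < x.2) (by simp)
      fun x => F x.2 x.1).symm
  have h3 : ∑ u, F u u = ∑ u, ∑ v, if u = v then F u v else 0 := by simp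
  rw [sum_add_distrib, h1, h2, h3, Fintype.sum_prod_type, Fintype.sum_prod_type]
  rw [sum_comm (f := fun x y => if (x, y).1 < (x, y).2 then F (x, y).2 (x, y).1 else 0)]
  simp only [← sum_add_distrib]
  refine sum_congr rfl fun u _ => sum_congr rfl fun v _ => ?_
  rcases lt_trichotomy u v with h | h | h
  · simp [h, h.not_gt, h.ne]
  · simp [h]
  · simp [h, h.not_gt, h.ne']

/-! ### Uniform discrepancy of edge counts. -/

section Events

variable {n : ℕ} {L : Type}

/-- The number of edges `u < v` with `u ∈ A` and `v ∈ B`. -/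
def crossEdges (X : LabeledGraph n L) (A B : Finset (Fin n)) : ℝ :=
  ∑ e : VertexPair n, if e.1.1 ∈ A ∧ e.1.2 ∈ B then edgeInd (X e) else 0

/-- An upper bound for the logarithm of the number of `s`-element subsets of an `n`-element set. -/
def setEntropy (n : ℕ) (s : ℕ) : ℝ := s * (1 + Real.log (n / s))

/-- The number of edges between any two vertex sets obeys exponential tail bounds, with an entropy
correction that makes them hold for all pairs of sets simultaneously. -/
def Discrepancy (p : ℝ) (X : LabeledGraph n L) : Prop :=
  ∀ A B : Finset (Fin n), ∀ k ∈ Icc 1 n, (k : ℝ) * crossEdges X A B ≤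
    Real.exp k * p * (#A * #B) + 3 * (setEntropy n #A + setEntropy n #B)

theorem choose_le_exp_setEntropy {s : ℕ} (hs : 1 ≤ s) (hsn : s ≤ n) :
    (n.choose s : ℝ) ≤ Real.exp (setEntropy n s) := by
  have hs0 : (0 : ℝ) < s := by exact_mod_cast hs
  have hn0 : (0 : ℝ) < n := by exact_mod_cast (by omega : 0 < n)
  have h1 : (n.choose s : ℝ) ≤ (n : ℝ) ^ s / (s.factorial : ℝ) := Nat.choose_le_pow_div s n
  have h2 : (s : ℝ) ^ s / (s.factorial : ℝ) ≤ Real.exp s :=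
    Real.pow_div_factorial_le_exp _ hs0.le _
  have h3 : Real.exp (setEntropy n s) = Real.exp s * ((n : ℝ) / s) ^ s := by
    rw [setEntropy, mul_add, mul_one, Real.exp_add, Real.exp_nat_mul, Real.exp_log (by positivity)]
  rw [h3]
  calc (n.choose s : ℝ) ≤ (n : ℝ) ^ s / (s.factorial : ℝ) := h1
    _ = (s : ℝ) ^ s / (s.factorial : ℝ) * ((n : ℝ) / s) ^ s := by
        rw [div_pow]; field_simp
    _ ≤ _ := mul_le_mul_of_nonneg_right h2 (by positivity)

theorem log_le_setEntropy {s : ℕ} (hs : 1 ≤ s) (hsn : s ≤ n) :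
    Real.log n ≤ setEntropy n s := by
  have hs1 : (1 : ℝ) ≤ s := by exact_mod_cast hs
  have hn0 : (0 : ℝ) < n := by exact_mod_cast (by omega : 0 < n)
  have hsn' : (s : ℝ) ≤ n := by exact_mod_cast hsn
  have h1 : 0 ≤ Real.log (n / s) := Real.log_nonneg ((one_le_div (by linarith)).2 hsn')
  have h2 : Real.log (n / s) = Real.log n - Real.log s :=
    Real.log_div hn0.ne' (by linarith)
  have h3 := Real.log_le_sub_one_of_pos (by linarith : (0 : ℝ) < s)
  rw [setEntropy]
  nlinarith

/-- Of the three entropies, one pays for the number of sets of a given size; the other two give n⁻²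
because the entropy is at least log n. Summing over n sizes leaves 1/n. -/
theorem sum_exp_setEntropy_le (hn : 1 ≤ n) :
    ∑ A ∈ (univ : Finset (Finset (Fin n))).filter (·.Nonempty),
      Real.exp (-(3 * setEntropy n #A)) ≤ 1 / n := by
  have hn0 : (0 : ℝ) < n := by exact_mod_cast hn
  have h1 : ∑ A ∈ (univ : Finset (Finset (Fin n))).filter (·.Nonempty),
      Real.exp (-(3 * setEntropy n #A)) =
      ∑ s ∈ Icc 1 n, (n.choose s : ℝ) * Real.exp (-(3 * setEntropy n s)) := by
    rw [← sum_fiberwise_of_maps_to (g := fun A : Finset (Fin n) => #A) (t := Icc 1 n)]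
    · refine sum_congr rfl fun s hs => ?_
      have : ((univ : Finset (Finset (Fin n))).filter (·.Nonempty)).filter (fun A => #A = s) =
          powersetCard s univ := by
        ext A
        simp only [mem_filter, mem_univ, true_and, mem_powersetCard, subset_univ]
        refine ⟨fun h => h.2, fun h => ⟨card_pos.1 ?_, h⟩⟩
        have := (mem_Icc.1 hs).1
        omega
      rw [this, sum_congr rfl (g := fun _ => Real.exp (-(3 * setEntropy n s)))
        fun A hA => by rw [(mem_powersetCard.1 hA).2], sum_const, card_powersetCard]
      simp
    · intro A hA
      rw [mem_Icc]
      exact ⟨card_pos.2 (mem_filter.1 hA).2, by simpa using card_le_univ A⟩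
  rw [h1]
  calc ∑ s ∈ Icc 1 n, (n.choose s : ℝ) * Real.exp (-(3 * setEntropy n s))
      ≤ ∑ s ∈ Icc 1 n, (1 / (n : ℝ)) ^ 2 := by
        refine sum_le_sum fun s hs => ?_
        obtain ⟨hs1, hs2⟩ := mem_Icc.1 hs
        have h2 := choose_le_exp_setEntropy hs1 hs2
        have h3 := log_le_setEntropy hs1 hs2
        calc (n.choose s : ℝ) * Real.exp (-(3 * setEntropy n s))
            ≤ Real.exp (setEntropy n s) * Real.exp (-(3 * setEntropy n s)) :=
              mul_le_mul_of_nonneg_right h2 (Real.exp_pos _).le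
          _ = Real.exp (-setEntropy n s) ^ 2 := by
              rw [← Real.exp_add, sq, ← Real.exp_add]; ring_nf
          _ ≤ Real.exp (-Real.log n) ^ 2 := by gcongr
          _ = (1 / (n : ℝ)) ^ 2 := by rw [Real.exp_neg, Real.exp_log hn0, one_div]
    _ = 1 / n := by
        rw [sum_const, Nat.card_Icc, nsmul_eq_mul, Nat.add_sub_cancel]
        field_simp

theorem card_vertexPair_filter_le (A B : Finset (Fin n)) :
    #{e : VertexPair n | e.1.1 ∈ A ∧ e.1.2 ∈ B} ≤ #A * #B := by
  rw [← card_product]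
  refine card_le_card_of_injOn (fun e => e.1) (fun e he => ?_) fun _ _ _ _ h => Subtype.ext h
  simpa using he

theorem crossEdges_of_isEmpty {X : LabeledGraph n L} {A B : Finset (Fin n)}
    (h : ¬(A.Nonempty ∧ B.Nonempty)) : crossEdges X A B = 0 :=
  sum_eq_zero fun _ _ => if_neg fun h' => h ⟨⟨_, h'.1⟩, ⟨_, h'.2⟩⟩

theorem setEntropy_nonneg {s : ℕ} (hsn : s ≤ n) : 0 ≤ setEntropy n s := by
  rcases Nat.eq_zero_or_pos s with rfl | hs
  · simp [setEntropy]
  · exact le_trans (Real.log_natCast_nonneg n) (log_le_setEntropy hs hsn)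

variable [Fintype L] {p q : ℝ} {μ ν : L → ℝ}

theorem edgeProb_le (hqp : q ≤ p) (same : Prop) [Decidable same] : edgeProb p q same ≤ p := by
  rw [edgeProb]; split_ifs <;> simp [hqp]

theorem edgeProb_nonneg (H : Admissible p q μ ν) (same : Prop) [Decidable same] :
    0 ≤ edgeProb p q same := by
  rw [edgeProb]; split_ifs
  · exact H.p_nonneg
  · exact H.q_nonneg

theorem prob_crossEdges_le (H : Admissible p q μ ν) (hqp : q ≤ p) (A B : Finset (Fin n)) (k : ℕ)
    (s : ℝ) :
    prob p q μ ν {ω : TypeAssignment n × LabeledGraph n L |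
      Real.exp k * p * (#A * #B) + s < k * crossEdges ω.2 A B} ≤ Real.exp (-s) := by
  refine le_trans (prob_mono H ?_) (prob_lt_sum_le_exp H Set.univ
    (fun _ e o => (if e.1.1 ∈ A ∧ e.1.2 ∈ B then (k : ℝ) else 0) * edgeInd o)
    (fun _ e => if e.1.1 ∈ A ∧ e.1.2 ∈ B then Real.exp k * p else 0) s ?_)
  · intro ω hω
    refine ⟨trivial, ?_⟩
    have h1 : ∑ e : VertexPair n, (if e.1.1 ∈ A ∧ e.1.2 ∈ B then (k : ℝ) else 0) *
        edgeInd (ω.2 e) = k * crossEdges ω.2 A B := by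
      rw [crossEdges, mul_sum]
      exact sum_congr rfl fun e _ => by split_ifs <;> simp
    have h2 : ∑ e : VertexPair n, (if e.1.1 ∈ A ∧ e.1.2 ∈ B then Real.exp k * p else 0) ≤
        Real.exp k * p * (#A * #B) := by
      rw [← sum_filter, sum_const, nsmul_eq_mul, mul_comm]
      refine mul_le_mul_of_nonneg_left ?_ (mul_nonneg (Real.exp_pos _).le H.p_nonneg)
      exact_mod_cast card_vertexPair_filter_le A B
    have h3 : Real.exp k * p * (#A * #B) + s < k * crossEdges ω.2 A B := hω
    simp only [h1]
    linarith
  · intro σ _ e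
    refine (sum_pairMass_mul_exp_edgeInd_le H _ _).trans (Real.exp_le_exp.2 ?_)
    have h1 := edgeProb_le hqp (σ e.1.1 = σ e.1.2)
    have h2 := edgeProb_nonneg H (σ e.1.1 = σ e.1.2)
    split_ifs
    · nlinarith [Real.exp_pos (k : ℝ)]
    · simp

/-- The union over `A` and `B` gives n⁻², and the n values of k cost one factor n. -/
theorem prob_not_discrepancy_le (H : Admissible p q μ ν) (hqp : q ≤ p) (hn : 1 ≤ n) :
    prob p q μ ν {ω : TypeAssignment n × LabeledGraph n L | ¬ Discrepancy p ω.2} ≤ 1 / n := by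
  have hn0 : (0 : ℝ) < n := by exact_mod_cast hn
  set N := (univ : Finset (Finset (Fin n))).filter (·.Nonempty)
  set s : Finset (Fin n) × Finset (Fin n) × ℕ → ℝ :=
    fun i => 3 * (setEntropy n #i.1 + setEntropy n #i.2.1)
  calc prob p q μ ν {ω : TypeAssignment n × LabeledGraph n L | ¬ Discrepancy p ω.2}
      ≤ prob p q μ ν {ω : TypeAssignment n × LabeledGraph n L | ∃ i ∈ N ×ˢ N ×ˢ Icc 1 n,
          ω ∈ {ω : TypeAssignment n × LabeledGraph n L |
            Real.exp i.2.2 * p * (#i.1 * #i.2.1) + s i < i.2.2 * crossEdges ω.2 i.1 i.2.1}} := by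
        refine prob_mono H fun ω hω => ?_
        simp only [Set.mem_ofPred_eq, Discrepancy, not_forall, not_le] at hω
        obtain ⟨A, B, k, hk, h⟩ := hω
        have hAB : A.Nonempty ∧ B.Nonempty := by
          by_contra hAB
          rw [crossEdges_of_isEmpty hAB, mul_zero] at h
          have h1 := setEntropy_nonneg (n := n) (s := #A) (by simpa using card_le_univ A)
          have h2 := setEntropy_nonneg (n := n) (s := #B) (by simpa using card_le_univ B)
          have h3 : 0 ≤ Real.exp k * p * (#A * #B) :=
            mul_nonneg (mul_nonneg (Real.exp_pos _).le H.p_nonneg) (by positivity)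
          linarith
        exact ⟨(A, B, k), by simp only [mem_product]; simp [N, hAB, mem_Icc.1 hk], h⟩
    _ ≤ ∑ i ∈ N ×ˢ N ×ˢ Icc 1 n, Real.exp (-s i) :=
        (prob_biUnion_le H _ _).trans
          (sum_le_sum fun i _ => prob_crossEdges_le H hqp i.1 i.2.1 i.2.2 (s i))
    _ = (∑ A ∈ N, Real.exp (-(3 * setEntropy n #A))) *
          ((∑ A ∈ N, Real.exp (-(3 * setEntropy n #A))) * n) := by
        have : (n : ℝ) = ∑ k ∈ Icc 1 n, 1 := by simp
        rw [this, sum_mul_sum, sum_mul_sum, sum_product]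
        refine sum_congr rfl fun A _ => ?_
        rw [sum_product]
        refine sum_congr rfl fun B _ => ?_
        rw [mul_sum]
        refine sum_congr rfl fun k _ => ?_
        rw [mul_one, ← Real.exp_add]
        simp only [s]
        ring_nf
    _ ≤ 1 / n * (1 / n * n) := by
        have h := sum_exp_setEntropy_le hn
        have h0 : 0 ≤ ∑ A ∈ N, Real.exp (-(3 * setEntropy n #A)) :=
          sum_nonneg fun _ _ => (Real.exp_pos _).le
        exact mul_le_mul h (mul_le_mul_of_nonneg_right h hn0.le) (by positivity) (by positivity)
    _ = 1 / n := by field_simp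

end Events

/-! ### Light pairs: an exponential bound at every lattice point. -/

section LightPairs

variable {n : ℕ} {L : Type}

/-- The lattice points `z / (4 √n)` in the unit ball, in terms of the integer vector `z`. -/
def netVector (z : Fin n → ℤ) (u : Fin n) : ℝ := z u / (4 * √n)

theorem sum_exp_neg_sq_le (N : ℕ) :
    ∑ z ∈ Icc (-(N : ℤ)) N, Real.exp (-(z : ℝ) ^ 2) ≤ 3 := by
  -- The correction term makes the induction close: the two new terms add at most 2 · 2^(-(N+1)).
  have key : ∀ N : ℕ, ∑ z ∈ Icc (-(N : ℤ)) N, Real.exp (-(z : ℝ) ^ 2) ≤ 3 - 2 * (1 / 2) ^ N := by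
    intro N
    induction N with
    | zero => norm_num
    | succ N ih =>
      have h1 : Icc (-((N + 1 : ℕ) : ℤ)) ((N + 1 : ℕ) : ℤ) =
          insert ((N : ℤ) + 1) (insert (-((N : ℤ) + 1)) (Icc (-(N : ℤ)) N)) := by
        ext z; simp only [mem_Icc, mem_insert]; push_cast; omega
      rw [h1, sum_insert (by simp only [mem_insert, mem_Icc]; omega),
        sum_insert (by simp only [mem_Icc]; omega)]
      have h2 : Real.exp (-((N : ℝ) + 1) ^ 2) ≤ (1 / 2) ^ (N + 1) := by
        have h3 : Real.exp (-1) ≤ 1 / 2 := by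
          rw [Real.exp_neg, inv_le_comm₀ (Real.exp_pos _) (by norm_num)]
          have := Real.add_one_le_exp (1 : ℝ)
          norm_num at this ⊢
          exact this
        calc Real.exp (-((N : ℝ) + 1) ^ 2) ≤ Real.exp (((N + 1 : ℕ) : ℝ) * (-1)) := by
              refine Real.exp_le_exp.2 ?_
              push_cast
              nlinarith [(Nat.cast_nonneg N : (0 : ℝ) ≤ N)]
          _ = Real.exp (-1) ^ (N + 1) := Real.exp_nat_mul _ _
          _ ≤ _ := pow_le_pow_left₀ (Real.exp_pos _).le h3 _
      push_cast
      have h4 : (-((N : ℝ) + 1)) ^ 2 = ((N : ℝ) + 1) ^ 2 := neg_sq _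
      have h5 : (1 / 2 : ℝ) ^ (N + 1) = (1 / 2) ^ N * (1 / 2) := pow_succ _ _
      rw [h4]
      rw [h5] at h2 ⊢
      linarith
  refine (key N).trans ?_
  have : (0 : ℝ) < (1 / 2) ^ N := by positivity
  linarith

theorem sum_vertexPair_sq_le (y : Fin n → ℝ) :
    ∑ e : VertexPair n, (y e.1.1 * y e.1.2) ^ 2 ≤ (∑ u, y u ^ 2) ^ 2 := by
  have h := sum_sum_eq_sum_vertexPair fun u v => y u ^ 2 * y v ^ 2
  rw [sq (∑ u, y u ^ 2), sum_mul_sum, h]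
  have h1 : 0 ≤ ∑ u, y u ^ 2 * y u ^ 2 := sum_nonneg fun _ _ => by positivity
  have h2 : ∑ e : VertexPair n, (y e.1.1 * y e.1.2) ^ 2 ≤
      ∑ e : VertexPair n, (y e.1.1 ^ 2 * y e.1.2 ^ 2 + y e.1.2 ^ 2 * y e.1.1 ^ 2) :=
    sum_le_sum fun e _ => by nlinarith [sq_nonneg (y e.1.1 * y e.1.2)]
  linarith

theorem sum_netVector_sq (hn : 1 ≤ n) (z : Fin n → ℤ) :
    ∑ u, netVector z u ^ 2 = (∑ u, (z u : ℝ) ^ 2) / (16 * n) := by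
  rw [sum_div]
  refine sum_congr rfl fun u _ => ?_
  rw [netVector, div_pow, mul_pow, Real.sq_sqrt (by positivity)]
  norm_num

variable [Fintype L] {p q : ℝ} {μ ν : L → ℝ}

/-- The expected weight of a pair. -/
def meanWeight (p q : ℝ) (μ ν w : L → ℝ) (σ : TypeAssignment n) (e : VertexPair n) : ℝ :=
  ∑ o, pairMass p q μ ν (σ e.1.1 = σ e.1.2) o * pairWeight w o

/-- The centered quadratic form, restricted to the pairs with `n |y_u y_v| ≤ 4 r`. -/
def lightForm (p q : ℝ) (μ ν w : L → ℝ) (r : ℝ) (ω : TypeAssignment n × LabeledGraph n L)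
    (y : Fin n → ℝ) : ℝ :=
  ∑ e : VertexPair n, if n * |y e.1.1 * y e.1.2| ≤ 4 * r then
    y e.1.1 * y e.1.2 * (pairWeight w (ω.2 e) - meanWeight p q μ ν w ω.1 e) else 0

/-- The exponent gains 19n from the threshold 76r and loses at most n/8 to the variance, leaving
more than 37n/2. -/
theorem prob_linear_le (H : Admissible p q μ ν) (hqp : q ≤ p) (hn : 1 ≤ n) {w : L → ℝ}
    (hw : ∀ ℓ, |w ℓ| ≤ 1) {r : ℝ} (hr : 1 ≤ r) (hp : n * p ≤ 2 * r ^ 2) (c : VertexPair n → ℝ)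
    (hc : ∀ e, n * |c e| ≤ 4 * r) (hc2 : ∑ e, c e ^ 2 ≤ 1) :
    prob p q μ ν {ω : TypeAssignment n × LabeledGraph n L | 76 * r <
      ∑ e, c e * (pairWeight w (ω.2 e) - meanWeight p q μ ν w ω.1 e)} ≤
      Real.exp (-(37 / 2 * n)) := by
  have hn0 : (0 : ℝ) < n := by exact_mod_cast hn
  -- The largest parameter that keeps every θ|c e| at most 1, as the moment bound requires.
  set θ : ℝ := n / (4 * r)
  have hθ : 0 < θ := by positivity
  refine le_trans (prob_mono H ?_) (prob_lt_sum_le_exp H Set.univ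
    (fun _ e o => θ * c e * pairWeight w o)
    (fun σ e => θ * c e * meanWeight p q μ ν w σ e +
      (θ * c e) ^ 2 * edgeProb p q (σ e.1.1 = σ e.1.2)) (37 / 2 * n) ?_)
  · intro ω hω
    refine ⟨trivial, ?_⟩
    have h1 : 76 * r < ∑ e, c e * (pairWeight w (ω.2 e) - meanWeight p q μ ν w ω.1 e) := hω
    have h2 : ∑ e, (θ * c e) ^ 2 * edgeProb p q (ω.1 e.1.1 = ω.1 e.1.2) ≤ n / 8 := by
      calc ∑ e, (θ * c e) ^ 2 * edgeProb p q (ω.1 e.1.1 = ω.1 e.1.2)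
          ≤ ∑ e, θ ^ 2 * p * c e ^ 2 := by
            refine sum_le_sum fun e _ => ?_
            rw [mul_pow, mul_right_comm]
            have := edgeProb_le hqp (ω.1 e.1.1 = ω.1 e.1.2)
            gcongr
        _ = θ ^ 2 * p * ∑ e, c e ^ 2 := by rw [mul_sum]
        _ ≤ θ ^ 2 * p * 1 :=
            mul_le_mul_of_nonneg_left hc2 (mul_nonneg (by positivity) H.p_nonneg)
        _ = n * (n * p) / (16 * r ^ 2) := by simp only [θ]; field_simp; ring
        _ ≤ n * (2 * r ^ 2) / (16 * r ^ 2) := by gcongr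
        _ = n / 8 := by field_simp; norm_num
    have h3 : ∑ e, θ * c e * pairWeight w (ω.2 e) - ∑ e, (θ * c e * meanWeight p q μ ν w ω.1 e +
        (θ * c e) ^ 2 * edgeProb p q (ω.1 e.1.1 = ω.1 e.1.2)) =
        θ * ∑ e, c e * (pairWeight w (ω.2 e) - meanWeight p q μ ν w ω.1 e) -
          ∑ e, (θ * c e) ^ 2 * edgeProb p q (ω.1 e.1.1 = ω.1 e.1.2) := by
      rw [sum_add_distrib, mul_sum, ← sub_sub, ← sum_sub_distrib]
      congr 1
      exact sum_congr rfl fun e _ => by ring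
    have h4 : θ * (76 * r) = 19 * n := by simp only [θ]; field_simp; norm_num
    have h5 := mul_le_mul_of_nonneg_left h1.le hθ.le
    simp only [h3]
    linarith
  · intro σ _ e
    refine sum_pairMass_mul_exp_pairWeight_le H _ hw ?_
    rw [abs_mul, abs_of_pos hθ]
    calc θ * |c e| = (n * |c e|) / (4 * r) := by simp only [θ]; ring
      _ ≤ 1 := (div_le_one (by positivity)).2 (hc e)

theorem prob_lightForm_le (H : Admissible p q μ ν) (hqp : q ≤ p) (hn : 1 ≤ n) {w : L → ℝ}
    (hw : ∀ ℓ, |w ℓ| ≤ 1) {r : ℝ} (hr : 1 ≤ r) (hp : n * p ≤ 2 * r ^ 2) (y : Fin n → ℝ)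
    (hy : ∑ u, y u ^ 2 ≤ 1) :
    prob p q μ ν {ω : TypeAssignment n × LabeledGraph n L |
      76 * r < |lightForm p q μ ν w r ω y|} ≤ 2 * Real.exp (-(37 / 2 * n)) := by
  set c : VertexPair n → ℝ := fun e =>
    if n * |y e.1.1 * y e.1.2| ≤ 4 * r then y e.1.1 * y e.1.2 else 0 with hcdef
  have hc : ∀ e, n * |c e| ≤ 4 * r := by
    intro e
    simp only [c]
    split_ifs with h
    · exact h
    · simp; linarith
  have hc2 : ∑ e, c e ^ 2 ≤ 1 := by
    calc ∑ e, c e ^ 2 ≤ ∑ e : VertexPair n, (y e.1.1 * y e.1.2) ^ 2 := by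
          refine sum_le_sum fun e _ => ?_
          simp only [c]
          split_ifs
          · exact le_rfl
          · simpa using sq_nonneg (y e.1.1 * y e.1.2)
      _ ≤ (∑ u, y u ^ 2) ^ 2 := sum_vertexPair_sq_le y
      _ ≤ 1 := pow_le_one₀ (sum_nonneg fun _ _ => by positivity) hy
  have hform : ∀ ω : TypeAssignment n × LabeledGraph n L, lightForm p q μ ν w r ω y =
      ∑ e, c e * (pairWeight w (ω.2 e) - meanWeight p q μ ν w ω.1 e) := by
    intro ω
    refine sum_congr rfl fun e _ => ?_
    simp only [c]
    split_ifs <;> simp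
  have h1 := prob_linear_le (n := n) H hqp hn hw hr hp c hc hc2
  have h2 := prob_linear_le (n := n) H hqp hn hw hr hp (fun e => -c e) (by simpa using hc)
    (by simpa using hc2)
  refine (prob_mono H ?_).trans ((prob_union_le H _ _).trans ((add_le_add h1 h2).trans
    (by linarith)))
  intro ω hω
  have h3 : 76 * r < |lightForm p q μ ν w r ω y| := hω
  rw [hform] at h3
  rcases lt_abs.1 h3 with h | h
  · exact Or.inl h
  · refine Or.inr ?_
    simpa [neg_mul] using h

/-- All lattice points in the unit ball have a small light part. -/
def LightBound (p q : ℝ) (μ ν w : L → ℝ) (r : ℝ) (ω : TypeAssignment n × LabeledGraph n L) :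
    Prop :=
  ∀ z : Fin n → ℤ, ∑ u, (z u : ℝ) ^ 2 ≤ 16 * n →
    |lightForm p q μ ν w r ω (netVector z)| ≤ 76 * r

/-- The net has at most exp(35n/2) points, one factor exp(n) less than the inverse tail at a single
point. -/
theorem prob_not_lightBound_le (H : Admissible p q μ ν) (hqp : q ≤ p) (hn : 1 ≤ n) {w : L → ℝ}
    (hw : ∀ ℓ, |w ℓ| ≤ 1) {r : ℝ} (hr : 1 ≤ r) (hp : n * p ≤ 2 * r ^ 2) :
    prob p q μ ν {ω : TypeAssignment n × LabeledGraph n L | ¬ LightBound p q μ ν w r ω} ≤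
      2 * Real.exp (-n) := by
  classical
  have hn0 : (0 : ℝ) < n := by exact_mod_cast hn
  -- A finite box containing all admissible z; its side length is irrelevant, since the Gaussian
  -- weights below sum to at most 3 per coordinate.
  set T : Finset (Fin n → ℤ) := Fintype.piFinset fun _ => Icc (-((16 * n : ℕ) : ℤ)) (16 * n : ℕ)
  set I := T.filter fun z => ∑ u, (z u : ℝ) ^ 2 ≤ 16 * n
  calc prob p q μ ν {ω : TypeAssignment n × LabeledGraph n L | ¬ LightBound p q μ ν w r ω}
      ≤ prob p q μ ν {ω : TypeAssignment n × LabeledGraph n L | ∃ z ∈ I,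
          ω ∈ {ω : TypeAssignment n × LabeledGraph n L |
            76 * r < |lightForm p q μ ν w r ω (netVector z)|}} := by
        refine prob_mono H fun ω hω => ?_
        simp only [Set.mem_ofPred_eq, LightBound, not_forall, not_le] at hω
        obtain ⟨z, hz, h⟩ := hω
        refine ⟨z, mem_filter.2 ⟨Fintype.mem_piFinset.2 fun u => ?_, hz⟩, h⟩
        have h1 : (z u : ℝ) ^ 2 ≤ 16 * n :=
          (single_le_sum (f := fun u => (z u : ℝ) ^ 2) (fun _ _ => by positivity)
            (mem_univ u)).trans hz
        have h2 : z u ^ 2 ≤ ((16 * n : ℕ) : ℤ) := by exact_mod_cast h1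
        rw [mem_Icc]
        constructor <;> nlinarith
    _ ≤ ∑ z ∈ I, 2 * Real.exp (-(37 / 2 * n)) := by
        refine (prob_biUnion_le H _ _).trans (sum_le_sum fun z hz => ?_)
        refine prob_lightForm_le H hqp hn hw hr hp _ ?_
        rw [sum_netVector_sq hn]
        exact (div_le_one (by positivity)).2 (mem_filter.1 hz).2
    -- Lattice points are counted with the weight exp(16n - Σ z_u²), which is at least 1 on the ball
    -- and factorizes over coordinates.
    _ ≤ ∑ z ∈ T, 2 * Real.exp (-(37 / 2 * n)) * (Real.exp (16 * n) *
          ∏ u, Real.exp (-(z u : ℝ) ^ 2)) := by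
        rw [sum_filter]
        refine sum_le_sum fun z _ => ?_
        split_ifs with h
        · refine le_mul_of_one_le_right (by positivity) ?_
          rw [← Real.exp_sum, ← Real.exp_add, sum_neg_distrib]
          exact Real.one_le_exp (by linarith)
        · exact mul_nonneg (by positivity) (mul_nonneg (Real.exp_pos _).le
            (prod_nonneg fun _ _ => (Real.exp_pos _).le))
    _ = 2 * Real.exp (-(37 / 2 * n)) * Real.exp (16 * n) *
          ∏ _u : Fin n, ∑ z ∈ Icc (-((16 * n : ℕ) : ℤ)) (16 * n : ℕ),
            Real.exp (-(z : ℝ) ^ 2) := by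
        rw [prod_univ_sum, mul_sum]
        exact sum_congr rfl fun z _ => by ring
    _ ≤ 2 * Real.exp (-(37 / 2 * n)) * Real.exp (16 * n) * Real.exp (3 / 2 * n) := by
        refine mul_le_mul_of_nonneg_left ?_ (by positivity)
        rw [prod_const, card_univ, Fintype.card_fin, mul_comm (3 / 2 : ℝ), Real.exp_nat_mul]
        refine pow_le_pow_left₀ (sum_nonneg fun _ _ => (Real.exp_pos _).le) ?_ _
        refine (sum_exp_neg_sq_le (16 * n)).trans ?_
        have := Real.quadratic_le_exp_of_nonneg (x := 3 / 2) (by norm_num)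
        norm_num at this ⊢
        linarith
    _ = 2 * Real.exp (-n) := by
        rw [mul_assoc, mul_assoc, ← Real.exp_add, ← Real.exp_add]
        ring_nf

end LightPairs

/-! ### Balanced types and the number of high-degree vertices. -/

section Degrees

variable {n : ℕ} {L : Type}

/-- The degree in terms of edge indicators. -/
theorem degree_eq_sum (X : LabeledGraph n L) (u : Fin n) :
    ((graph X).degree u : ℝ) = ∑ v, edgeInd (edgeLabel X u v) := by
  have h : ∀ v, edgeInd (edgeLabel X u v) = if (graph X).Adj u v then 1 else 0 := by
    intro v
    change _ = if (edgeLabel X u v).isSome = true then (1 : ℝ) else 0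
    cases edgeLabel X u v <;> simp [edgeInd]
  rw [← SimpleGraph.card_neighborFinset_eq_degree, SimpleGraph.neighborFinset_eq_filter,
    sum_congr rfl fun v _ => h v]
  simp

theorem edgeLabel_pair (X : LabeledGraph n L) (e : VertexPair n) :
    edgeLabel X e.1.1 e.1.2 = X e := by
  rw [edgeLabel, dif_pos e.2]

theorem edgeLabel_pair_symm (X : LabeledGraph n L) (e : VertexPair n) :
    edgeLabel X e.1.2 e.1.1 = X e := by
  rw [edgeLabel_comm, edgeLabel_pair]

theorem edgeLabel_self (X : LabeledGraph n L) (u : Fin n) : edgeLabel X u u = none := by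
  simp [edgeLabel]

/-- The vertices of degree larger than `t`. -/
def highDegree (t : ℝ) (X : LabeledGraph n L) : Finset (Fin n) :=
  {u | t < ((graph X).degree u : ℝ)}

/-- The number of endpoints of a pair in a vertex set. -/
def endpointCount (A : Finset (Fin n)) (e : VertexPair n) : ℝ :=
  (if e.1.1 ∈ A then 1 else 0) + (if e.1.2 ∈ A then 1 else 0)

theorem endpointCount_nonneg (A : Finset (Fin n)) (e : VertexPair n) : 0 ≤ endpointCount A e := by
  unfold endpointCount; positivity

theorem endpointCount_le (A : Finset (Fin n)) (e : VertexPair n) : endpointCount A e ≤ 2 := by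
  unfold endpointCount; split_ifs <;> norm_num

theorem sum_ite_mem_univ (A : Finset (Fin n)) (f : Fin n → Fin n → ℝ) :
    (∑ u, ∑ v, if u ∈ A then f u v else 0) = ∑ u ∈ A, ∑ v, f u v := by
  calc (∑ u, ∑ v, if u ∈ A then f u v else 0) = ∑ u, if u ∈ A then ∑ v, f u v else 0 :=
        sum_congr rfl fun u _ => by split_ifs <;> simp
    _ = _ := by simp

theorem sum_degree_eq (X : LabeledGraph n L) (A : Finset (Fin n)) :
    ∑ u ∈ A, ((graph X).degree u : ℝ) = ∑ e, endpointCount A e * edgeInd (X e) := by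
  have h := sum_sum_eq_sum_vertexPair fun u v =>
    if u ∈ A then edgeInd (edgeLabel X u v) else 0
  simp only [edgeLabel_pair, edgeLabel_pair_symm, edgeLabel_self] at h
  calc ∑ u ∈ A, ((graph X).degree u : ℝ)
      = ∑ u, ∑ v, if u ∈ A then edgeInd (edgeLabel X u v) else 0 := by
        simp only [degree_eq_sum]
        rw [← sum_ite_mem_univ A]
    _ = ∑ e, endpointCount A e * edgeInd (X e) := by
        rw [h]
        simp [endpointCount, edgeInd, add_mul]

theorem abs_units_cast (s : ℤˣ) : |((s : ℤ) : ℝ)| = 1 := by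
  rcases Int.units_eq_one_or s with rfl | rfl <;> simp

theorem units_cast_mul_self (s : ℤˣ) : ((s : ℤ) : ℝ) * ((s : ℤ) : ℝ) = 1 := by
  rcases Int.units_eq_one_or s with rfl | rfl <;> simp

/-- The two types have nearly the same size. -/
def Balanced (σ : TypeAssignment n) : Prop := |∑ u, ((σ u : ℤ) : ℝ)| ≤ n / 10

theorem edgeProb_eq (p q : ℝ) (σ : TypeAssignment n) (u v : Fin n) :
    edgeProb p q (σ u = σ v) =
      (p + q) / 2 + (p - q) / 2 * (((σ u : ℤ) : ℝ) * ((σ v : ℤ) : ℝ)) := by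
  rcases Int.units_eq_one_or (σ u) with h | h <;> rcases Int.units_eq_one_or (σ v) with h' | h' <;>
    simp [edgeProb, h, h'] <;> ring

theorem sum_edgeProb_le {p q d : ℝ} (hq : 0 ≤ q) (hqp : q ≤ p) (hd : n * (p + q) = 2 * d)
    {σ : TypeAssignment n} (hσ : Balanced σ) (u : Fin n) :
    ∑ v, edgeProb p q (σ u = σ v) ≤ 11 / 10 * d := by
  simp only [edgeProb_eq, sum_add_distrib, ← mul_sum, sum_const, card_univ, Fintype.card_fin,
    nsmul_eq_mul]
  have h1 : ((σ u : ℤ) : ℝ) * ∑ v, ((σ v : ℤ) : ℝ) ≤ n / 10 := by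
    refine (le_abs_self _).trans ?_
    rw [abs_mul, abs_units_cast, one_mul]
    exact hσ
  have h2 := mul_le_mul_of_nonneg_left h1 (by linarith : 0 ≤ (p - q) / 2)
  have h3 : (0 : ℝ) ≤ n * q := by positivity
  nlinarith

variable [Fintype L] {p q : ℝ} {μ ν : L → ℝ}

theorem sum_endpointCount_mul_edgeProb_le (H : Admissible p q μ ν) {d : ℝ} (hqp : q ≤ p)
    (hd : n * (p + q) = 2 * d) {σ : TypeAssignment n} (hσ : Balanced σ) (A : Finset (Fin n)) :
    ∑ e : VertexPair n, endpointCount A e * edgeProb p q (σ e.1.1 = σ e.1.2) ≤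
      #A * (11 / 10 * d) := by
  have h := sum_sum_eq_sum_vertexPair fun u v =>
    if u ∈ A then edgeProb p q (σ u = σ v) else 0
  have h0 : 0 ≤ ∑ u, if u ∈ A then edgeProb p q (σ u = σ u) else 0 :=
    sum_nonneg fun u _ => by
      split_ifs
      · exact edgeProb_nonneg H _
      · exact le_rfl
  calc ∑ e : VertexPair n, endpointCount A e * edgeProb p q (σ e.1.1 = σ e.1.2)
      = ∑ e : VertexPair n, ((if e.1.1 ∈ A then edgeProb p q (σ e.1.1 = σ e.1.2) else 0) +
          if e.1.2 ∈ A then edgeProb p q (σ e.1.2 = σ e.1.1) else 0) := by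
        refine sum_congr rfl fun e _ => ?_
        rw [edgeProb_eq, edgeProb_eq p q σ e.1.2, mul_comm ((σ e.1.2 : ℤ) : ℝ)]
        simp [endpointCount, add_mul]
    _ ≤ ∑ u, ∑ v, if u ∈ A then edgeProb p q (σ u = σ v) else 0 := by linarith
    _ = ∑ u ∈ A, ∑ v, edgeProb p q (σ u = σ v) := by
        rw [← sum_ite_mem_univ A]
    _ ≤ ∑ u ∈ A, 11 / 10 * d := sum_le_sum fun u _ => sum_edgeProb_le H.q_nonneg hqp hd hσ u
    _ = _ := by rw [sum_const, nsmul_eq_mul]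

/-- For a fixed `A` the degree sum is a sum over independent pairs, with pairs inside `A` counted
twice. At parameter 1/11 the exponent is |A|d(3/22 - (13/121)(11/10)) = |A|d/55 > 2n. -/
theorem prob_subset_highDegree_le (H : Admissible p q μ ν) {d : ℝ} (hqp : q ≤ p)
    (hd : n * (p + q) = 2 * d) (A : Finset (Fin n)) (hA : 110 * n < #A * d) :
    prob p q μ ν {ω : TypeAssignment n × LabeledGraph n L |
      Balanced ω.1 ∧ A = highDegree (3 / 2 * d) ω.2} ≤ Real.exp (-(2 * n)) := by
  refine le_trans (prob_mono H ?_) (prob_lt_sum_le_exp H {σ | Balanced σ}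
    (fun _ e o => 1 / 11 * endpointCount A e * edgeInd o)
    (fun σ e => edgeProb p q (σ e.1.1 = σ e.1.2) *
      (Real.exp (1 / 11 * endpointCount A e) - 1)) (2 * n)
    fun σ _ e => sum_pairMass_mul_exp_edgeInd_le H _ _)
  rintro ω ⟨hω, hAω⟩
  refine ⟨hω, ?_⟩
  have h1 : #A * (3 / 2 * d) ≤ ∑ e, endpointCount A e * edgeInd (ω.2 e) := by
    rw [← sum_degree_eq, ← nsmul_eq_mul]
    refine card_nsmul_le_sum _ _ _ fun u hu => ?_
    rw [hAω] at hu
    exact (mem_filter.1 hu).2.le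
  have h2 := sum_endpointCount_mul_edgeProb_le H hqp hd hω A
  have h3 : ∑ e : VertexPair n, edgeProb p q (ω.1 e.1.1 = ω.1 e.1.2) *
      (Real.exp (1 / 11 * endpointCount A e) - 1) ≤
      13 / 121 * ∑ e : VertexPair n, endpointCount A e * edgeProb p q (ω.1 e.1.1 = ω.1 e.1.2) := by
    rw [mul_sum]
    refine sum_le_sum fun e _ => ?_
    have h4 := endpointCount_nonneg A e
    have h5 := endpointCount_le A e
    have h6 : |1 / 11 * endpointCount A e| ≤ 1 := by
      rw [abs_of_nonneg (by positivity)]; linarith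
    have h7 := (abs_le.1 (Real.abs_exp_sub_one_sub_id_le h6)).2
    have h8 : Real.exp (1 / 11 * endpointCount A e) - 1 ≤ 13 / 121 * endpointCount A e := by
      nlinarith
    have := mul_le_mul_of_nonneg_left h8 (edgeProb_nonneg H (ω.1 e.1.1 = ω.1 e.1.2))
    linarith
  have h9 : ∑ e, 1 / 11 * endpointCount A e * edgeInd (ω.2 e) =
      1 / 11 * ∑ e, endpointCount A e * edgeInd (ω.2 e) := by
    rw [mul_sum]
    exact sum_congr rfl fun e _ => by ring
  simp only [h9]
  linarith

/-- Union bound over at most 2ⁿ ≤ exp(n) candidates for the set of high-degree vertices. -/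
theorem prob_highDegree_le (H : Admissible p q μ ν) {d : ℝ} (hqp : q ≤ p)
    (hd : n * (p + q) = 2 * d) :
    prob p q μ ν {ω : TypeAssignment n × LabeledGraph n L |
      Balanced ω.1 ∧ 110 * n < #(highDegree (3 / 2 * d) ω.2) * d} ≤ Real.exp (-n) := by
  set I := (univ : Finset (Finset (Fin n))).filter fun A => 110 * (n : ℝ) < #A * d
  calc prob p q μ ν {ω : TypeAssignment n × LabeledGraph n L |
      Balanced ω.1 ∧ 110 * n < #(highDegree (3 / 2 * d) ω.2) * d}
      ≤ prob p q μ ν {ω : TypeAssignment n × LabeledGraph n L | ∃ A ∈ I,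
          ω ∈ {ω : TypeAssignment n × LabeledGraph n L |
            Balanced ω.1 ∧ A = highDegree (3 / 2 * d) ω.2}} :=
        prob_mono H fun ω hω => ⟨_, mem_filter.2 ⟨mem_univ _, hω.2⟩, hω.1, rfl⟩
    _ ≤ ∑ A ∈ I, Real.exp (-(2 * n)) := (prob_biUnion_le H _ _).trans
        (sum_le_sum fun A hA => prob_subset_highDegree_le H hqp hd A (mem_filter.1 hA).2)
    _ ≤ ∑ A : Finset (Fin n), Real.exp (-(2 * n)) :=
        sum_le_sum_of_subset_of_nonneg (filter_subset _ _) fun _ _ _ => (Real.exp_pos _).le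
    _ = 2 ^ n * Real.exp (-(2 * n)) := by simp
    _ ≤ Real.exp n * Real.exp (-(2 * n)) := by
        refine mul_le_mul_of_nonneg_right ?_ (Real.exp_pos _).le
        have h : (2 : ℝ) ≤ Real.exp 1 := by linarith [Real.add_one_le_exp (1 : ℝ)]
        calc (2 : ℝ) ^ n ≤ Real.exp 1 ^ n := pow_le_pow_left₀ (by norm_num) h n
          _ = Real.exp n := by rw [← Real.exp_nat_mul, mul_one]
    _ = Real.exp (-n) := by rw [← Real.exp_add]; ring_nf

theorem sum_exp_type_le (θ : ℝ) :
    ∑ σ : TypeAssignment n, Real.exp (θ * ∑ u, ((σ u : ℤ) : ℝ)) ≤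
      2 ^ n * Real.exp (n * (θ ^ 2 / 2)) := by
  have h : ∀ σ : TypeAssignment n, Real.exp (θ * ∑ u, ((σ u : ℤ) : ℝ)) =
      ∏ u, Real.exp (θ * ((σ u : ℤ) : ℝ)) := fun σ => by rw [← Real.exp_sum, mul_sum]
  have h2 : ∑ s : ℤˣ, Real.exp (θ * ((s : ℤ) : ℝ)) = 2 * Real.cosh θ := by
    rw [UnitsInt.univ, sum_insert (by decide), sum_singleton, Real.cosh_eq]
    simp
    ring
  rw [sum_congr rfl fun σ _ => h σ,
    ← Fintype.prod_sum fun (_ : Fin n) (s : ℤˣ) => Real.exp (θ * ((s : ℤ) : ℝ))]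
  rw [prod_const, h2, card_univ, Fintype.card_fin, mul_pow, Real.exp_nat_mul]
  have := Real.cosh_le_exp_half_sq θ
  have h3 := Real.cosh_pos θ
  gcongr

theorem prob_not_balanced_le (H : Admissible p q μ ν) :
    prob p q μ ν {ω : TypeAssignment n × LabeledGraph n L | ¬ Balanced ω.1} ≤
      2 * Real.exp (-(n / 200)) := by
  set f : TypeAssignment n → ℝ := fun σ => Real.exp (1 / 10 * ∑ u, ((σ u : ℤ) : ℝ)) +
    Real.exp (-(1 / 10) * ∑ u, ((σ u : ℤ) : ℝ))
  have key : ∀ σ : TypeAssignment n, ¬ Balanced σ → 1 ≤ Real.exp (-(n / 100)) * f σ := by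
    intro σ hσ
    rw [Balanced, not_le] at hσ
    simp only [f]
    rw [mul_add, ← Real.exp_add, ← Real.exp_add]
    rcases lt_abs.1 hσ with h | h
    · have : 1 ≤ Real.exp (-(n / 100 : ℝ) + 1 / 10 * ∑ u, ((σ u : ℤ) : ℝ)) :=
        Real.one_le_exp (by linarith)
      linarith [Real.exp_pos (-(n / 100 : ℝ) + -(1 / 10) * ∑ u, ((σ u : ℤ) : ℝ))]
    · have : 1 ≤ Real.exp (-(n / 100 : ℝ) + -(1 / 10) * ∑ u, ((σ u : ℤ) : ℝ)) :=
        Real.one_le_exp (by linarith)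
      linarith [Real.exp_pos (-(n / 100 : ℝ) + 1 / 10 * ∑ u, ((σ u : ℤ) : ℝ))]
  calc prob p q μ ν {ω : TypeAssignment n × LabeledGraph n L | ¬ Balanced ω.1}
      ≤ ∑ ω : TypeAssignment n × LabeledGraph n L,
          mass p q μ ν ω * (Real.exp (-(n / 100)) * f ω.1) := by
        refine sum_le_sum fun ω _ => ?_
        have h0 := mass_nonneg H ω
        by_cases h : ¬ Balanced ω.1
        · rw [Set.indicator_of_mem (by exact h)]
          exact le_mul_of_one_le_right h0 (key _ h)
        · rw [Set.indicator_of_notMem (by exact h)]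
          positivity
    _ = (2 : ℝ)⁻¹ ^ n * (Real.exp (-(n / 100)) * ∑ σ : TypeAssignment n, f σ) := by
        rw [sum_mass_mul H fun σ => Real.exp (-(n / 100)) * f σ, ← mul_sum]
    _ ≤ (2 : ℝ)⁻¹ ^ n * (Real.exp (-(n / 100)) * (2 * (2 ^ n * Real.exp (n / 200)))) := by
        refine mul_le_mul_of_nonneg_left (mul_le_mul_of_nonneg_left ?_ (Real.exp_pos _).le)
          (by positivity)
        have h1 := sum_exp_type_le (n := n) (1 / 10)
        have h2 := sum_exp_type_le (n := n) (-(1 / 10))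
        have h3 : (n : ℝ) * ((1 / 10) ^ 2 / 2) = n / 200 := by ring
        have h4 : (n : ℝ) * ((-(1 / 10)) ^ 2 / 2) = n / 200 := by ring
        rw [h3] at h1
        rw [h4] at h2
        simp only [f, sum_add_distrib]
        linarith
    _ = 2 * (Real.exp (-(n / 100)) * Real.exp (n / 200)) := by
        rw [inv_pow]; field_simp
    _ = 2 * Real.exp (-(n / 200)) := by rw [← Real.exp_add]; ring_nf

end Degrees

/-! ### Heavy pairs: dyadic level sets and discrepancy. -/

section HeavyPairs

variable {n : ℕ} {L : Type}

/-- The inequality 1 + x ≤ exp x at x = log(n/s) - (3i+1), a tangent bound. The slope is chosen so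
that the error n · 8⁻ⁱ stays summable after multiplication by 4ⁱ. -/
theorem setEntropy_le (n s i : ℕ) :
    setEntropy n s ≤ s * (3 * i + 1) + n * (1 / 8) ^ i := by
  have h8 : Real.exp (-(3 * i + 1)) ≤ (1 / 8) ^ i := by
    have h2 : (2 : ℝ) ≤ Real.exp 1 := by linarith [Real.add_one_le_exp (1 : ℝ)]
    have h3 : (8 : ℝ) ^ i ≤ Real.exp (3 * i + 1) := by
      calc (8 : ℝ) ^ i ≤ (Real.exp 1 ^ 3) ^ i := by
            refine pow_le_pow_left₀ (by norm_num) ?_ _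
            calc (8 : ℝ) = 2 ^ 3 := by norm_num
              _ ≤ _ := pow_le_pow_left₀ (by norm_num) h2 _
        _ = Real.exp (3 * i) := by
            rw [← pow_mul, ← Real.exp_nat_mul]; push_cast; ring_nf
        _ ≤ _ := Real.exp_le_exp.2 (by linarith)
    rw [Real.exp_neg, one_div, inv_pow]
    exact inv_anti₀ (by positivity) h3
  refine le_trans ?_ (add_le_add_right (mul_le_mul_of_nonneg_left h8 (Nat.cast_nonneg n)) _)
  rcases Nat.eq_zero_or_pos s with rfl | hs
  · simp only [setEntropy, Nat.cast_zero, zero_mul, zero_add]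
    positivity
  rcases Nat.eq_zero_or_pos n with rfl | hn
  · simp only [setEntropy, Nat.cast_zero, zero_div, Real.log_zero, zero_mul, add_zero]
    refine mul_le_mul_of_nonneg_left ?_ (Nat.cast_nonneg s)
    linarith [(Nat.cast_nonneg i : (0 : ℝ) ≤ i)]
  have hs0 : (0 : ℝ) < s := by exact_mod_cast hs
  have hn0 : (0 : ℝ) < n := by exact_mod_cast hn
  have h1 := Real.add_one_le_exp (Real.log (n / s) - (3 * i + 1))
  rw [Real.exp_sub, Real.exp_log (by positivity)] at h1
  have h2 := mul_le_mul_of_nonneg_left h1 hs0.le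
  have h3 : (s : ℝ) * (n / s / Real.exp (3 * i + 1)) = n * Real.exp (-(3 * i + 1)) := by
    rw [Real.exp_neg]; field_simp
  rw [h3] at h2
  rw [setEntropy]
  linarith

theorem sum_geometric_reflect_le (N M : ℕ) :
    ∑ j ∈ (range N).filter (· ≤ M), (3 / 4 : ℝ) ^ (M - j) ≤ 4 := by
  calc ∑ j ∈ (range N).filter (· ≤ M), (3 / 4 : ℝ) ^ (M - j)
      ≤ ∑ j ∈ range (M + 1), (3 / 4 : ℝ) ^ (M - j) := by
        refine sum_le_sum_of_subset_of_nonneg (fun j hj => ?_) fun _ _ _ => by positivity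
        have := (mem_filter.1 hj).2
        exact mem_range.2 (by omega)
    _ = ∑ j ∈ range (M + 1), (3 / 4 : ℝ) ^ j := by
        rw [← sum_range_reflect]
        refine sum_congr rfl fun j hj => ?_
        have := mem_range.1 hj
        congr 1
        omega
    _ ≤ 4 := by
        rw [geom_sum_eq (by norm_num)]
        have : (0 : ℝ) < (3 / 4) ^ (M + 1) := by positivity
        rw [div_le_iff_of_neg (by norm_num)]
        linarith

/-- The dyadic level sets of a function. -/
def levelSet (t : Fin n → ℝ) (i : ℕ) : Finset (Fin n) := {u | 2 ^ i ≤ t u ∧ t u < 2 ^ (i + 1)}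

theorem disjoint_levelSet (t : Fin n → ℝ) {i j : ℕ} (h : i < j) :
    Disjoint (levelSet t i) (levelSet t j) := by
  rw [disjoint_left]
  intro u hi hj
  have h1 := (mem_filter.1 hi).2.2
  have h2 := (mem_filter.1 hj).2.1
  have h3 : (2 : ℝ) ^ (i + 1) ≤ 2 ^ j := pow_le_pow_right₀ (by norm_num) h
  linarith

/-- The share of a level set in the squared norm. -/
def levelShare (t : Fin n → ℝ) (i : ℕ) : ℝ := (∑ u ∈ levelSet t i, t u ^ 2) / n

theorem levelShare_nonneg (t : Fin n → ℝ) (i : ℕ) : 0 ≤ levelShare t i :=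
  div_nonneg (sum_nonneg fun _ _ => by positivity) (Nat.cast_nonneg n)

theorem sum_levelShare_le (t : Fin n → ℝ) (ht : ∑ u, t u ^ 2 ≤ n) (N : ℕ) :
    ∑ i ∈ range N, levelShare t i ≤ 1 := by
  classical
  simp only [levelShare]
  rw [← sum_div, ← sum_biUnion]
  · refine div_le_one_of_le₀ (le_trans ?_ ht) (Nat.cast_nonneg n)
    exact sum_le_sum_of_subset_of_nonneg (subset_univ _) fun _ _ _ => by positivity
  · intro i _ j _ hij
    rcases lt_or_gt_of_ne hij with h | h
    · exact disjoint_levelSet t h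
    · exact (disjoint_levelSet t h).symm

theorem card_levelSet_le (hn : 1 ≤ n) (t : Fin n → ℝ) (i : ℕ) :
    #(levelSet t i) * (4 : ℝ) ^ i ≤ n * levelShare t i := by
  have hn0 : (0 : ℝ) < n := by exact_mod_cast hn
  rw [levelShare, mul_div_cancel₀ _ hn0.ne', ← nsmul_eq_mul]
  refine card_nsmul_le_sum _ _ _ fun u hu => ?_
  have h := (mem_filter.1 hu).2.1
  calc (4 : ℝ) ^ i = (2 ^ i) ^ 2 := by rw [← pow_mul, mul_comm, pow_mul]; norm_num
    _ ≤ t u ^ 2 := pow_le_pow_left₀ (by positivity) h 2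

theorem four_pow_mul_setEntropy_levelSet_le (hn : 1 ≤ n) (t : Fin n → ℝ) (i : ℕ) :
    4 ^ i * setEntropy n #(levelSet t i) ≤
      n * (3 * i + 1) * (levelShare t i + (1 / 2) ^ i) := by
  have h1 := setEntropy_le n #(levelSet t i) i
  have h2 := card_levelSet_le hn t i
  have h3 : (4 : ℝ) ^ i * (1 / 8) ^ i = (1 / 2) ^ i := by rw [← mul_pow]; norm_num
  have h4 := mul_le_mul_of_nonneg_left h1 (by positivity : (0 : ℝ) ≤ 4 ^ i)
  have h5 : (0 : ℝ) ≤ 3 * i := by positivity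
  have h6 : (0 : ℝ) < (1 / 2) ^ i := by positivity
  have h7 : (0 : ℝ) ≤ n := Nat.cast_nonneg n
  calc 4 ^ i * setEntropy n #(levelSet t i)
      ≤ 4 ^ i * (#(levelSet t i) * (3 * i + 1) + n * (1 / 8) ^ i) := h4
    _ = #(levelSet t i) * 4 ^ i * (3 * i + 1) + n * (4 ^ i * (1 / 8) ^ i) := by ring
    _ ≤ n * levelShare t i * (3 * i + 1) + n * ((3 * i + 1) * (1 / 2) ^ i) := by
        rw [h3]
        gcongr
        nlinarith
    _ = _ := by ring

theorem add_two_le_mul_pow (m : ℕ) : (m : ℝ) + 2 ≤ 2 * (3 / 2) ^ m := by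
  induction m with
  | zero => norm_num
  | succ m ih =>
    rw [pow_succ]
    push_cast
    linarith [(Nat.cast_nonneg m : (0 : ℝ) ≤ m)]

/-- With m = i + h - j the claim reduces to 3i + 1 ≤ 6(3/2)^m k. It follows from i + 1 ≤ (m+2)k:
either i ≤ m, or j > h and then 2k already exceeds i. This removes the factor 3i + 1 of the entropy
bound at the price of replacing 1/2 by 3/4. -/
theorem two_pow_mul_le {h i j : ℕ} (hij : h ≤ i + j) (hj : j ≤ i + h) :
    (2 : ℝ) ^ j * (3 * i + 1) ≤
      6 * 2 ^ h * 2 ^ i * (3 / 4) ^ (i + h - j) * ((1 + (i + j - h) / 2 : ℕ) : ℝ) := by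
  obtain ⟨m, hm⟩ : ∃ m, m + j = i + h := ⟨i + h - j, by omega⟩
  have h1 : i + h - j = m := by omega
  rw [h1]
  set k := 1 + (i + j - h) / 2 with hk
  have h2 : i + 1 ≤ (m + 2) * k := by
    rcases le_or_gt i m with h3 | h3
    · have : 1 ≤ k := by omega
      nlinarith
    · have : i + 1 ≤ 2 * k := by omega
      nlinarith
  have h3 : ((i : ℝ) + 1) ≤ (m + 2) * k := by exact_mod_cast h2
  have h4 : (2 : ℝ) ^ h * 2 ^ i = 2 ^ m * 2 ^ j := by rw [← pow_add, ← pow_add, hm, add_comm]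
  have h5 : (2 : ℝ) ^ m * (3 / 4) ^ m = (3 / 2) ^ m := by rw [← mul_pow]; norm_num
  have h6 := mul_le_mul_of_nonneg_right (add_two_le_mul_pow m) (Nat.cast_nonneg (α := ℝ) k)
  calc (2 : ℝ) ^ j * (3 * i + 1) ≤ 2 ^ j * (3 * (2 * (3 / 2) ^ m * k)) := by
        gcongr
        linarith
    _ = 6 * (2 ^ m * 2 ^ j) * (3 / 4) ^ m * k := by rw [← h5]; ring
    _ = _ := by rw [← h4]; ring

theorem two_pow_mul_setEntropy_le (hn : 1 ≤ n) (t : Fin n → ℝ) {h i j : ℕ} (hij : h ≤ i + j)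
    (hj : j ≤ i + h) :
    (2 : ℝ) ^ (i + j) * setEntropy n #(levelSet t i) ≤ ((1 + (i + j - h) / 2 : ℕ) : ℝ) *
      (6 * 2 ^ h * n * ((3 / 4) ^ (i + h - j) * (levelShare t i + (1 / 2) ^ i))) := by
  have h1 := four_pow_mul_setEntropy_levelSet_le hn t i
  have h2 := two_pow_mul_le hij hj
  set k : ℝ := ((1 + (i + j - h) / 2 : ℕ) : ℝ)
  have h4 : (4 : ℝ) ^ i = 2 ^ i * 2 ^ i := by rw [← mul_pow]; norm_num
  have h5 : (0 : ℝ) < 2 ^ i := by positivity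
  have h6 := levelShare_nonneg t i
  refine le_of_mul_le_mul_left ?_ h5
  calc (2 : ℝ) ^ i * (2 ^ (i + j) * setEntropy n #(levelSet t i))
      = 2 ^ j * (4 ^ i * setEntropy n #(levelSet t i)) := by rw [h4, pow_add]; ring
    _ ≤ 2 ^ j * (n * (3 * i + 1) * (levelShare t i + (1 / 2) ^ i)) := by gcongr
    _ = 2 ^ j * (3 * i + 1) * (n * (levelShare t i + (1 / 2) ^ i)) := by ring
    _ ≤ 6 * 2 ^ h * 2 ^ i * (3 / 4) ^ (i + h - j) * k *
          (n * (levelShare t i + (1 / 2) ^ i)) := by gcongr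
    _ = _ := by ring

theorem exp_level_le {h i j : ℕ} (hij : h ≤ i + j) :
    Real.exp ((1 + (i + j - h) / 2 : ℕ) : ℝ) * 2 ^ h ≤ 3 * 2 ^ (i + j) := by
  have he : Real.exp 1 ≤ 3 := by linarith [Real.exp_one_lt_d9]
  set k := (i + j - h) / 2 with hk
  calc Real.exp ((1 + k : ℕ) : ℝ) * 2 ^ h = Real.exp 1 * (Real.exp 1 ^ k * 2 ^ h) := by
        rw [← Real.exp_nat_mul, ← mul_assoc, ← Real.exp_add]; push_cast; ring_nf
    _ ≤ 3 * (4 ^ k * 2 ^ h) := by gcongr; linarith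
    _ = 3 * 2 ^ (2 * k + h) := by rw [pow_add, pow_mul]; norm_num
    _ ≤ 3 * 2 ^ (i + j) := by
        refine mul_le_mul_of_nonneg_left (pow_le_pow_right₀ (by norm_num) (by omega))
          (by norm_num)

/-- Discrepancy is applied with e^k of order 2^(i+j-h). The density term then gives the product of
the shares, and dividing by k turns the entropy terms into geometrically decaying ones; 18 is 3 · 6.
-/
theorem two_pow_mul_crossEdges_le {X : LabeledGraph n L} {p : ℝ} (hn : 1 ≤ n)
    (hX : Discrepancy p X) {h : ℕ} (hp0 : 0 ≤ p) (hp : n * p ≤ 2 * ((2 : ℝ) ^ h) ^ 2)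
    (t : Fin n → ℝ) {i j : ℕ} (hi : i < n) (hij : h ≤ i + j) (h1 : j ≤ i + h)
    (h2 : i ≤ j + h) :
    2 ^ (i + j) * crossEdges X (levelSet t i) (levelSet t j) ≤
      2 ^ h * n * (6 * (levelShare t i * levelShare t j) +
        18 * ((3 / 4) ^ (i + h - j) * (levelShare t i + (1 / 2) ^ i)) +
        18 * ((3 / 4) ^ (j + h - i) * (levelShare t j + (1 / 2) ^ j))) := by
  have hn0 : (0 : ℝ) < n := by exact_mod_cast hn
  -- Here k ≤ n because j ≤ i + h gives k ≤ i + 1 ≤ n.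
  have hk := hX (levelSet t i) (levelSet t j) (1 + (i + j - h) / 2) (mem_Icc.2 (by omega))
  have hξi := two_pow_mul_setEntropy_le hn t hij h1
  have hξj := two_pow_mul_setEntropy_le hn t (i := j) (j := i) (h := h) (by omega) h2
  rw [add_comm j i] at hξj
  have hexp := exp_level_le hij
  have hk1 : (1 : ℝ) ≤ ((1 + (i + j - h) / 2 : ℕ) : ℝ) := by
    exact_mod_cast (by omega : 1 ≤ 1 + (i + j - h) / 2)
  set k : ℝ := ((1 + (i + j - h) / 2 : ℕ) : ℝ)
  have hbi := card_levelSet_le hn t i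
  have hbj := card_levelSet_le hn t j
  have hai := levelShare_nonneg t i
  have haj := levelShare_nonneg t j
  set r : ℝ := 2 ^ h
  have hr : 0 < r := by positivity
  have hmain : (2 : ℝ) ^ (i + j) * (Real.exp k * p * (#(levelSet t i) * #(levelSet t j))) ≤
      6 * r * n * (levelShare t i * levelShare t j) := by
    have h4 : (2 : ℝ) ^ (i + j) * 2 ^ (i + j) = 4 ^ i * 4 ^ j := by
      rw [← mul_pow, ← pow_add]; norm_num
    refine le_of_mul_le_mul_left ?_ (mul_pos hr hn0)
    calc r * n * ((2 : ℝ) ^ (i + j) * (Real.exp k * p * (#(levelSet t i) * #(levelSet t j))))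
        = 2 ^ (i + j) * (Real.exp k * r) * (n * p) * (#(levelSet t i) * #(levelSet t j)) := by
          ring
      _ ≤ 2 ^ (i + j) * (3 * 2 ^ (i + j)) * (2 * r ^ 2) *
            (#(levelSet t i) * #(levelSet t j)) := by gcongr
      _ = 6 * r ^ 2 * ((2 ^ (i + j) * 2 ^ (i + j)) * (#(levelSet t i) * #(levelSet t j))) := by
          ring
      _ = 6 * r ^ 2 * ((#(levelSet t i) * 4 ^ i) * (#(levelSet t j) * 4 ^ j)) := by
          rw [h4]; ring
      _ ≤ 6 * r ^ 2 * ((n * levelShare t i) * (n * levelShare t j)) := by gcongr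
      _ = _ := by ring
  have hmain' : (2 : ℝ) ^ (i + j) * (Real.exp k * p * (#(levelSet t i) * #(levelSet t j))) ≤
      k * (6 * r * n * (levelShare t i * levelShare t j)) :=
    hmain.trans (le_mul_of_one_le_left (by positivity) hk1)
  have hE : (0 : ℝ) ≤ 2 ^ (i + j) := by positivity
  have hfin := mul_le_mul_of_nonneg_left hk hE
  refine le_of_mul_le_mul_left ?_ (by linarith : 0 < k)
  linarith

/-- The geometric series in j is at most 4; the shares sum to at most 1 and the powers of 1/2 to at
most 2. -/
theorem sum_level_pairs_le (t : Fin n → ℝ) (ht : ∑ u, t u ^ 2 ≤ n) (h : ℕ) :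
    ∑ i ∈ range n, ∑ j ∈ (range n).filter (· ≤ i + h),
      (3 / 4 : ℝ) ^ (i + h - j) * (levelShare t i + (1 / 2) ^ i) ≤ 12 := by
  have h1 : ∑ i ∈ range n, (1 / 2 : ℝ) ^ i ≤ 2 := by
    rw [geom_sum_eq (by norm_num)]
    rw [div_le_iff_of_neg (by norm_num)]
    have : (0 : ℝ) < (1 / 2) ^ n := by positivity
    linarith
  have h2 := sum_levelShare_le t ht n
  calc ∑ i ∈ range n, ∑ j ∈ (range n).filter (· ≤ i + h),
        (3 / 4 : ℝ) ^ (i + h - j) * (levelShare t i + (1 / 2) ^ i)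
      ≤ ∑ i ∈ range n, 4 * (levelShare t i + (1 / 2) ^ i) := by
        refine sum_le_sum fun i _ => ?_
        rw [← sum_mul]
        have := levelShare_nonneg t i
        exact mul_le_mul_of_nonneg_right (sum_geometric_reflect_le n (i + h)) (by positivity)
    _ ≤ 12 := by
        rw [← mul_sum, sum_add_distrib]
        linarith

theorem sum_levels_crossEdges_le {X : LabeledGraph n L} {p : ℝ} (hn : 1 ≤ n)
    (hX : Discrepancy p X) {h : ℕ} (hp0 : 0 ≤ p) (hp : n * p ≤ 2 * ((2 : ℝ) ^ h) ^ 2)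
    (t : Fin n → ℝ) (ht : ∑ u, t u ^ 2 ≤ n) :
    ∑ x ∈ (range n ×ˢ range n).filter
        (fun x => h ≤ x.1 + x.2 ∧ x.2 ≤ x.1 + h ∧ x.1 ≤ x.2 + h),
      2 ^ (x.1 + x.2) * crossEdges X (levelSet t x.1) (levelSet t x.2) ≤ 438 * (2 ^ h * n) := by
  set P := (range n ×ˢ range n).filter
    (fun x => h ≤ x.1 + x.2 ∧ x.2 ≤ x.1 + h ∧ x.1 ≤ x.2 + h)
  have hnn : ∀ i, 0 ≤ levelShare t i := levelShare_nonneg t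
  have hnn' : ∀ k i, 0 ≤ (3 / 4 : ℝ) ^ k * (levelShare t i + (1 / 2) ^ i) := fun k i =>
    mul_nonneg (by positivity) (add_nonneg (hnn i) (by positivity))
  have h1 : ∑ x ∈ P, levelShare t x.1 * levelShare t x.2 ≤ 1 := by
    calc ∑ x ∈ P, levelShare t x.1 * levelShare t x.2
        ≤ ∑ x ∈ range n ×ˢ range n, levelShare t x.1 * levelShare t x.2 :=
          sum_le_sum_of_subset_of_nonneg (filter_subset _ _) fun x _ _ =>
            mul_nonneg (hnn _) (hnn _)
      _ = (∑ i ∈ range n, levelShare t i) * ∑ i ∈ range n, levelShare t i := by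
          rw [sum_product, sum_mul_sum]
      _ ≤ 1 := mul_le_one₀ (sum_levelShare_le t ht n) (sum_nonneg fun i _ => hnn i)
          (sum_levelShare_le t ht n)
  have h2 : ∑ x ∈ P, (3 / 4 : ℝ) ^ (x.1 + h - x.2) * (levelShare t x.1 + (1 / 2) ^ x.1) ≤ 12 := by
    refine le_trans ?_ (sum_level_pairs_le t ht h)
    calc ∑ x ∈ P, (3 / 4 : ℝ) ^ (x.1 + h - x.2) * (levelShare t x.1 + (1 / 2) ^ x.1)
        ≤ ∑ x ∈ (range n ×ˢ range n).filter (fun x => x.2 ≤ x.1 + h),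
          (3 / 4 : ℝ) ^ (x.1 + h - x.2) * (levelShare t x.1 + (1 / 2) ^ x.1) :=
          sum_le_sum_of_subset_of_nonneg
            (fun x hx => mem_filter.2 ⟨(mem_filter.1 hx).1, (mem_filter.1 hx).2.2.1⟩)
            fun x _ _ => hnn' _ _
      _ = _ := by
          rw [sum_filter, sum_product]
          simp only [sum_filter]
  have h3 : ∑ x ∈ P, (3 / 4 : ℝ) ^ (x.2 + h - x.1) * (levelShare t x.2 + (1 / 2) ^ x.2) ≤ 12 := by
    refine le_trans ?_ (sum_level_pairs_le t ht h)
    calc ∑ x ∈ P, (3 / 4 : ℝ) ^ (x.2 + h - x.1) * (levelShare t x.2 + (1 / 2) ^ x.2)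
        ≤ ∑ x ∈ (range n ×ˢ range n).filter (fun x => x.1 ≤ x.2 + h),
          (3 / 4 : ℝ) ^ (x.2 + h - x.1) * (levelShare t x.2 + (1 / 2) ^ x.2) :=
          sum_le_sum_of_subset_of_nonneg
            (fun x hx => mem_filter.2 ⟨(mem_filter.1 hx).1, (mem_filter.1 hx).2.2.2⟩)
            fun x _ _ => hnn' _ _
      _ = _ := by
          rw [sum_filter, sum_product_right]
          simp only [sum_filter]
  calc ∑ x ∈ P, 2 ^ (x.1 + x.2) * crossEdges X (levelSet t x.1) (levelSet t x.2)
      ≤ ∑ x ∈ P, 2 ^ h * n * (6 * (levelShare t x.1 * levelShare t x.2) +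
        18 * ((3 / 4) ^ (x.1 + h - x.2) * (levelShare t x.1 + (1 / 2) ^ x.1)) +
        18 * ((3 / 4) ^ (x.2 + h - x.1) * (levelShare t x.2 + (1 / 2) ^ x.2))) := by
        refine sum_le_sum fun x hx => ?_
        obtain ⟨hx1, hx2, hx3, hx4⟩ := mem_filter.1 hx
        have hx5 := (mem_product.1 hx1).1
        exact two_pow_mul_crossEdges_le hn hX hp0 hp t (mem_range.1 hx5) hx2
          hx3 hx4
    _ = 2 ^ h * n * (6 * ∑ x ∈ P, levelShare t x.1 * levelShare t x.2 +
        18 * ∑ x ∈ P, (3 / 4 : ℝ) ^ (x.1 + h - x.2) * (levelShare t x.1 + (1 / 2) ^ x.1) +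
        18 * ∑ x ∈ P, (3 / 4 : ℝ) ^ (x.2 + h - x.1) * (levelShare t x.2 + (1 / 2) ^ x.2)) := by
        rw [← mul_sum, sum_add_distrib, sum_add_distrib, ← mul_sum, ← mul_sum, ← mul_sum]
    _ ≤ 2 ^ h * n * (6 * 1 + 18 * 12 + 18 * 12) := by gcongr
    _ = 438 * (2 ^ h * n) := by ring

theorem exists_mem_levelSet {t : Fin n → ℝ} (ht : ∑ u, t u ^ 2 ≤ n) {u : Fin n} (hu : 1 ≤ t u) :
    ∃ i < n, u ∈ levelSet t i := by
  obtain ⟨i, h1, h2⟩ := exists_nat_pow_near hu (by norm_num : (1 : ℝ) < 2)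
  refine ⟨i, ?_, mem_filter.2 ⟨mem_univ _, h1, h2⟩⟩
  have h3 : t u ^ 2 ≤ n :=
    (single_le_sum (f := fun u => t u ^ 2) (fun _ _ => by positivity) (mem_univ u)).trans ht
  have h4 : (i : ℝ) < 2 ^ i := by exact_mod_cast Nat.lt_two_pow_self
  have h5 : (1 : ℝ) ≤ 2 ^ i := one_le_pow₀ (by norm_num)
  have h6 : (i : ℝ) < n := by nlinarith
  exact_mod_cast h6

/-- A heavy pair has an endpoint that dominates the other one, or its endpoints lie in two level
sets that are close to each other. -/
theorem heavy_pair_cases {t : Fin n → ℝ} (ht0 : ∀ u, 0 ≤ t u) (ht : ∑ u, t u ^ 2 ≤ n) {h : ℕ}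
    {u v : Fin n} (huv : 4 * 2 ^ h < t u * t v) :
    t u * t v ≤ (t u ^ 2 + t v ^ 2) / 2 ^ h ∨ ∃ i < n, ∃ j < n,
      (h ≤ i + j ∧ j ≤ i + h ∧ i ≤ j + h) ∧ u ∈ levelSet t i ∧ v ∈ levelSet t j ∧
        t u * t v ≤ 4 * 2 ^ (i + j) := by
  have hr : (1 : ℝ) ≤ 2 ^ h := one_le_pow₀ (by norm_num)
  have hu := ht0 u
  have hv := ht0 v
  have key : ∀ {x y : ℝ}, 0 ≤ x → 0 ≤ y → 2 ^ h * y ≤ x → x * y ≤ (x ^ 2 + y ^ 2) / 2 ^ h := by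
    intro x y hx hy hxy
    rw [le_div_iff₀ (by positivity)]
    nlinarith
  rcases le_or_gt (2 ^ h * t v) (t u) with h1 | h1
  · exact Or.inl (key hu hv h1)
  rcases le_or_gt (2 ^ h * t u) (t v) with h2 | h2
  · left
    rw [mul_comm, add_comm]
    exact key hv hu h2
  right
  have hu1 : 1 ≤ t u := by
    by_contra hlt
    nlinarith
  have hv1 : 1 ≤ t v := by
    by_contra hlt
    nlinarith
  obtain ⟨i, hi, hui⟩ := exists_mem_levelSet ht hu1
  obtain ⟨j, hj, hvj⟩ := exists_mem_levelSet ht hv1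
  obtain ⟨hi1, hi2⟩ := (mem_filter.1 hui).2
  obtain ⟨hj1, hj2⟩ := (mem_filter.1 hvj).2
  have hprod : t u * t v ≤ 4 * 2 ^ (i + j) := by
    calc t u * t v ≤ 2 ^ (i + 1) * 2 ^ (j + 1) := by gcongr
      _ = 4 * 2 ^ (i + j) := by ring
  refine ⟨i, hi, j, hj, ⟨?_, ?_, ?_⟩, hui, hvj, hprod⟩
  · have : (2 : ℝ) ^ h < 2 ^ (i + j) := by linarith
    exact ((pow_lt_pow_iff_right₀ (by norm_num)).1 this).le
  · have : (2 : ℝ) ^ j < 2 ^ (i + h + 1) := by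
      calc (2 : ℝ) ^ j ≤ t v := hj1
        _ < 2 ^ h * t u := h2
        _ ≤ 2 ^ h * 2 ^ (i + 1) := by gcongr
        _ = 2 ^ (i + h + 1) := by ring
    have := (pow_lt_pow_iff_right₀ (by norm_num : (1 : ℝ) < 2)).1 this
    omega
  · have : (2 : ℝ) ^ i < 2 ^ (j + h + 1) := by
      calc (2 : ℝ) ^ i ≤ t u := hi1
        _ < 2 ^ h * t v := h1
        _ ≤ 2 ^ h * 2 ^ (j + 1) := by gcongr
        _ = 2 ^ (j + h + 1) := by ring
    have := (pow_lt_pow_iff_right₀ (by norm_num : (1 : ℝ) < 2)).1 this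
    omega

/-- Pairs with a dominating endpoint are charged to Σ t_u² deg(u) ≤ 2r²n, which costs 2rn after
division by r. The remaining pairs cost 4 · 438 · rn through the level sets. -/
theorem heavy_sum_le {X : LabeledGraph n L} {p : ℝ} (hn : 1 ≤ n)
    (hX : Discrepancy p X) {h : ℕ} (hp0 : 0 ≤ p) (hp : n * p ≤ 2 * ((2 : ℝ) ^ h) ^ 2)
    {t : Fin n → ℝ} (ht0 : ∀ u, 0 ≤ t u) (ht : ∑ u, t u ^ 2 ≤ n)
    (hdeg : ∀ u, t u ≠ 0 → ((graph X).degree u : ℝ) ≤ 2 * ((2 : ℝ) ^ h) ^ 2) :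
    ∑ e : VertexPair n, (if 4 * 2 ^ h < t e.1.1 * t e.1.2 then
      t e.1.1 * t e.1.2 * edgeInd (X e) else 0) ≤ 1754 * (2 ^ h * n) := by
  set r : ℝ := 2 ^ h with hrdef
  have hr : 0 < r := by positivity
  set P := (range n ×ˢ range n).filter
    (fun x => h ≤ x.1 + x.2 ∧ x.2 ≤ x.1 + h ∧ x.1 ≤ x.2 + h)
  set g : VertexPair n → ℕ × ℕ → ℝ := fun e x =>
    if e.1.1 ∈ levelSet t x.1 ∧ e.1.2 ∈ levelSet t x.2 then edgeInd (X e) else 0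
  have hg : ∀ e x, 0 ≤ g e x := fun e x => by
    simp only [g]
    split_ifs
    · exact edgeInd_nonneg _
    · exact le_rfl
  have hpt : ∀ e : VertexPair n, (if 4 * r < t e.1.1 * t e.1.2 then
      t e.1.1 * t e.1.2 * edgeInd (X e) else 0) ≤
      (t e.1.1 ^ 2 + t e.1.2 ^ 2) * edgeInd (X e) / r +
        ∑ x ∈ P, 4 * (2 ^ (x.1 + x.2) * g e x) := by
    intro e
    have ha := edgeInd_nonneg (X e)
    have hA : 0 ≤ (t e.1.1 ^ 2 + t e.1.2 ^ 2) * edgeInd (X e) / r := by positivity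
    have hterm : ∀ x ∈ P, 0 ≤ 4 * (2 ^ (x.1 + x.2) * g e x) := fun x _ =>
      mul_nonneg (by norm_num) (mul_nonneg (by positivity) (hg e x))
    have hB := sum_nonneg hterm
    split_ifs with hlt
    · rcases heavy_pair_cases ht0 ht hlt with h1 | ⟨i, hi, j, hj, hij, hui, hvj, hle⟩
      · have := mul_le_mul_of_nonneg_right h1 ha
        rw [div_mul_eq_mul_div] at this
        linarith
      · have hmem : (i, j) ∈ P :=
          mem_filter.2 ⟨mem_product.2 ⟨mem_range.2 hi, mem_range.2 hj⟩, hij⟩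
        have h1 := single_le_sum hterm hmem
        have h2 : g e (i, j) = edgeInd (X e) := if_pos ⟨hui, hvj⟩
        rw [h2] at h1
        have := mul_le_mul_of_nonneg_right hle ha
        linarith
    · linarith
  have hdegsum : ∑ e : VertexPair n, (t e.1.1 ^ 2 + t e.1.2 ^ 2) * edgeInd (X e) ≤
      2 * r ^ 2 * n := by
    have h1 := sum_sum_eq_sum_vertexPair fun u v => t u ^ 2 * edgeInd (edgeLabel X u v)
    simp only [edgeLabel_pair, edgeLabel_pair_symm, edgeLabel_self] at h1
    calc ∑ e : VertexPair n, (t e.1.1 ^ 2 + t e.1.2 ^ 2) * edgeInd (X e)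
        = ∑ u, ∑ v, t u ^ 2 * edgeInd (edgeLabel X u v) := by
          rw [h1]
          simp [edgeInd, add_mul]
      _ = ∑ u, t u ^ 2 * ((graph X).degree u : ℝ) := by
          simp only [degree_eq_sum, mul_sum]
      _ ≤ ∑ u, t u ^ 2 * (2 * r ^ 2) := by
          refine sum_le_sum fun u _ => ?_
          by_cases hu : t u = 0
          · simp [hu]
          · exact mul_le_mul_of_nonneg_left (hdeg u hu) (by positivity)
      _ ≤ n * (2 * r ^ 2) := by
          rw [← sum_mul]
          exact mul_le_mul_of_nonneg_right ht (by positivity)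
      _ = _ := by ring
  have hlev := sum_levels_crossEdges_le hn hX hp0 hp t ht
  calc ∑ e : VertexPair n, (if 4 * r < t e.1.1 * t e.1.2 then
      t e.1.1 * t e.1.2 * edgeInd (X e) else 0)
      ≤ ∑ e : VertexPair n, ((t e.1.1 ^ 2 + t e.1.2 ^ 2) * edgeInd (X e) / r +
        ∑ x ∈ P, 4 * (2 ^ (x.1 + x.2) * g e x)) := sum_le_sum fun e _ => hpt e
    _ = (∑ e : VertexPair n, (t e.1.1 ^ 2 + t e.1.2 ^ 2) * edgeInd (X e)) / r +
        4 * ∑ x ∈ P, 2 ^ (x.1 + x.2) * crossEdges X (levelSet t x.1) (levelSet t x.2) := by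
        rw [sum_add_distrib, ← sum_div, sum_comm, mul_sum]
        congr 1
        refine sum_congr rfl fun x _ => ?_
        rw [crossEdges, ← mul_sum, ← mul_sum]
    _ ≤ 2 * r ^ 2 * n / r + 4 * (438 * (r * n)) := by gcongr
    _ = 1754 * (r * n) := by field_simp; ring

end HeavyPairs

/-! ### Discretization of the unit ball, top vectors and signs. -/

section QuadraticForms

variable {n : ℕ}

/-- The quadratic form of a matrix. -/
def quadForm (A : Matrix (Fin n) (Fin n) ℝ) (y : Fin n → ℝ) : ℝ := y ⬝ᵥ A.mulVec y

theorem quadForm_eq_sum (A : Matrix (Fin n) (Fin n) ℝ) (y : Fin n → ℝ) :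
    quadForm A y = ∑ u, ∑ v, y u * y v * A u v := by
  simp only [quadForm, dotProduct, Matrix.mulVec, mul_sum]
  exact sum_congr rfl fun u _ => sum_congr rfl fun v _ => by ring

theorem quadForm_smul (A : Matrix (Fin n) (Fin n) ℝ) (c : ℝ) (y : Fin n → ℝ) :
    quadForm A (c • y) = c ^ 2 * quadForm A y := by
  simp only [quadForm, Matrix.mulVec_smul, dotProduct_smul, smul_dotProduct, smul_eq_mul]
  ring

theorem continuous_quadForm (A : Matrix (Fin n) (Fin n) ℝ) : Continuous (quadForm A) := by
  have : quadForm A = fun y => ∑ u, ∑ v, y u * y v * A u v := funext (quadForm_eq_sum A)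
  rw [this]
  fun_prop

theorem quadForm_sub_of_isSymm {A : Matrix (Fin n) (Fin n) ℝ} (hA : A.IsSymm) (x y : Fin n → ℝ) :
    quadForm A x - quadForm A y = (x - y) ⬝ᵥ A.mulVec (x + y) := by
  have h : x ⬝ᵥ A.mulVec y = y ⬝ᵥ A.mulVec x := by
    rw [Matrix.dotProduct_mulVec, ← Matrix.mulVec_transpose, hA.eq, dotProduct_comm]
  simp only [quadForm, sub_dotProduct, Matrix.mulVec_add, dotProduct_add]
  linarith

theorem quadForm_polarization {A : Matrix (Fin n) (Fin n) ℝ} (hA : A.IsSymm) (x y : Fin n → ℝ) :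
    quadForm A (x + y) - quadForm A (x - y) = 4 * (x ⬝ᵥ A.mulVec y) := by
  have h : x ⬝ᵥ A.mulVec y = y ⬝ᵥ A.mulVec x := by
    rw [Matrix.dotProduct_mulVec, ← Matrix.mulVec_transpose, hA.eq, dotProduct_comm]
  simp only [quadForm, sub_dotProduct, add_dotProduct, Matrix.mulVec_add, Matrix.mulVec_sub,
    dotProduct_add, dotProduct_sub]
  linarith

theorem exists_int_abs_le (x : ℝ) : ∃ z : ℤ, |(z : ℝ)| ≤ |x| ∧ |x - z| ≤ 1 := by
  rcases le_total 0 x with h | h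
  · refine ⟨⌊x⌋, ?_, ?_⟩
    · rw [abs_of_nonneg h, abs_of_nonneg (by exact_mod_cast Int.floor_nonneg.2 h)]
      exact Int.floor_le x
    · rw [abs_of_nonneg (by linarith [Int.floor_le x])]
      linarith [Int.lt_floor_add_one x]
  · refine ⟨⌈x⌉, ?_, ?_⟩
    · have h1 : ⌈x⌉ ≤ 0 := Int.ceil_le.2 (by simpa using h)
      rw [abs_of_nonpos h, abs_of_nonpos (by exact_mod_cast h1)]
      linarith [Int.le_ceil x]
    · rw [abs_of_nonpos (by linarith [Int.le_ceil x])]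
      linarith [Int.ceil_lt_add_one x]

/-- Rounding each coordinate towards zero cannot leave the ball, and moves it by at most 1/(4√n). -/
theorem exists_netVector (hn : 1 ≤ n) (y : Fin n → ℝ) (hy : ∑ u, y u ^ 2 ≤ 1) :
    ∃ z : Fin n → ℤ, ∑ u, (z u : ℝ) ^ 2 ≤ 16 * n ∧ ∑ u, netVector z u ^ 2 ≤ 1 ∧
      ∑ u, (y u - netVector z u) ^ 2 ≤ 1 / 16 := by
  have hn0 : (0 : ℝ) < n := by exact_mod_cast hn
  have hs : 0 < 4 * √(n : ℝ) := by positivity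
  choose z hz1 hz2 using fun u => exists_int_abs_le (4 * √n * y u)
  have h1 : ∑ u, (z u : ℝ) ^ 2 ≤ 16 * n := by
    calc ∑ u, (z u : ℝ) ^ 2 ≤ ∑ u, (4 * √(n : ℝ) * y u) ^ 2 :=
          sum_le_sum fun u _ => sq_le_sq.2 (hz1 u)
      _ = 16 * n * ∑ u, y u ^ 2 := by
          rw [mul_sum]
          refine sum_congr rfl fun u _ => ?_
          rw [mul_pow, mul_pow, Real.sq_sqrt hn0.le]
          norm_num
      _ ≤ 16 * n := mul_le_of_le_one_right (by positivity) hy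
  refine ⟨z, h1, ?_, ?_⟩
  · rw [sum_netVector_sq hn]
    exact (div_le_one (by positivity)).2 h1
  · calc ∑ u, (y u - netVector z u) ^ 2 ≤ ∑ _u : Fin n, 1 / (16 * (n : ℝ)) := by
          refine sum_le_sum fun u _ => ?_
          have h2 : y u - netVector z u = (4 * √n * y u - z u) / (4 * √n) := by
            rw [netVector, sub_div, mul_div_cancel_left₀ _ hs.ne']
          have h3 : (4 * √n * y u - z u) ^ 2 ≤ 1 := (sq_le_one_iff_abs_le_one _).2 (hz2 u)
          rw [h2, div_pow, mul_pow, Real.sq_sqrt hn0.le]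
          norm_num only
          exact div_le_div_of_nonneg_right h3 (by positivity)
      _ = 1 / 16 := by
          rw [sum_const, card_univ, Fintype.card_fin, nsmul_eq_mul]
          field_simp

theorem isCompact_sum_sq_le : IsCompact {y : Fin n → ℝ | ∑ u, y u ^ 2 ≤ 1} := by
  refine Metric.isCompact_of_isClosed_isBounded
    (isClosed_le (by fun_prop) continuous_const) ?_
  refine (Metric.isBounded_closedBall (x := (0 : Fin n → ℝ)) (r := 1)).subset fun y hy => ?_
  rw [mem_closedBall_zero_iff, pi_norm_le_iff_of_nonneg zero_le_one]
  intro u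
  rw [Real.norm_eq_abs, ← sq_le_one_iff_abs_le_one]
  exact (single_le_sum (f := fun u => y u ^ 2) (fun _ _ => by positivity) (mem_univ u)).trans hy

/-- A symmetric form that is bounded on the lattice points of the unit ball is bounded on the
whole unit ball. -/
theorem abs_quadForm_le_of_net (hn : 1 ≤ n) {A : Matrix (Fin n) (Fin n) ℝ} (hA : A.IsSymm) {c : ℝ}
    (h : ∀ z : Fin n → ℤ, ∑ u, (z u : ℝ) ^ 2 ≤ 16 * n → |quadForm A (netVector z)| ≤ c)
    (y : Fin n → ℝ) (hy : ∑ u, y u ^ 2 ≤ 1) : |quadForm A y| ≤ 2 * c := by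
  obtain ⟨y₀, hy₀, hmax⟩ := (isCompact_sum_sq_le (n := n)).exists_isMaxOn ⟨y, hy⟩
    (continuous_quadForm A).abs.continuousOn
  have hmax' : ∀ y, ∑ u, y u ^ 2 ≤ 1 → |quadForm A y| ≤ |quadForm A y₀| := fun y hy => hmax hy
  refine (hmax' y hy).trans ?_
  set N := |quadForm A y₀|
  have hN : 0 ≤ N := abs_nonneg _
  have hscale : ∀ y, |quadForm A y| ≤ N * ∑ u, y u ^ 2 := by
    intro y
    rcases (sum_nonneg fun u _ => sq_nonneg (y u) : 0 ≤ ∑ u, y u ^ 2).eq_or_lt with h0 | h0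
    · have hy0 : y = 0 := funext fun u => by
        have := (sum_eq_zero_iff_of_nonneg fun u _ => sq_nonneg (y u)).1 h0.symm u (mem_univ u)
        simpa using this
      rw [← h0, hy0]
      simp [quadForm]
    · have hsq : (√(∑ u, y u ^ 2))⁻¹ ^ 2 = (∑ u, y u ^ 2)⁻¹ := by
        rw [inv_pow, Real.sq_sqrt h0.le]
      have h1 := hmax' ((√(∑ u, y u ^ 2))⁻¹ • y) (by
        simp only [Pi.smul_apply, smul_eq_mul, mul_pow, ← mul_sum]
        rw [hsq, inv_mul_cancel₀ h0.ne'])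
      rw [quadForm_smul, abs_mul, hsq, abs_of_pos (inv_pos.2 h0), inv_mul_le_iff₀ h0] at h1
      linarith
  obtain ⟨z, hz, hz1, hz2⟩ := exists_netVector hn y₀ hy₀
  set y' := netVector z
  -- The difference of the two values is the bilinear form at y₀ - y' and y₀ + y', of norms at most
  -- 1/4 and 2. Scaling by 8 makes both norms at most 2, so polarization bounds the difference by
  -- N/2.
  set a : Fin n → ℝ := (8 : ℝ) • (y₀ - y')
  set b : Fin n → ℝ := y₀ + y'
  have ha : ∑ u, a u ^ 2 ≤ 4 := by
    simp only [a, Pi.smul_apply, Pi.sub_apply, smul_eq_mul, mul_pow, ← mul_sum]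
    linarith
  have hb : ∑ u, b u ^ 2 ≤ 4 := by
    have h1 : ∑ u, b u ^ 2 ≤ 2 * ∑ u, y₀ u ^ 2 + 2 * ∑ u, y' u ^ 2 := by
      rw [mul_sum, mul_sum, ← sum_add_distrib]
      refine sum_le_sum fun u _ => ?_
      simp only [b, Pi.add_apply]
      linarith [sq_nonneg (y₀ u - y' u)]
    have h2 : ∑ u, y₀ u ^ 2 ≤ 1 := hy₀
    linarith
  have hpar : ∑ u, (a + b) u ^ 2 + ∑ u, (a - b) u ^ 2 = 2 * ∑ u, a u ^ 2 + 2 * ∑ u, b u ^ 2 := by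
    rw [mul_sum, mul_sum, ← sum_add_distrib, ← sum_add_distrib]
    refine sum_congr rfl fun u _ => ?_
    simp only [Pi.add_apply, Pi.sub_apply]
    ring
  have h1 := hscale (a + b)
  have h2 := hscale (a - b)
  have h3 := quadForm_polarization hA a b
  rw [smul_dotProduct, ← quadForm_sub_of_isSymm hA, smul_eq_mul] at h3
  have h4 := h z hz
  have h5 : N * ∑ u, (a + b) u ^ 2 + N * ∑ u, (a - b) u ^ 2 ≤ 16 * N := by
    rw [← mul_add, hpar]
    nlinarith
  have h6 : |quadForm A y₀ - quadForm A y'| ≤ N / 2 := by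
    rw [abs_le] at h1 h2 ⊢
    constructor <;> linarith [h1.1, h1.2, h2.1, h2.2]
  have h7 : N ≤ |quadForm A y'| + |quadForm A y₀ - quadForm A y'| := by
    have := abs_add_le (quadForm A y') (quadForm A y₀ - quadForm A y')
    rwa [add_sub_cancel] at this
  linarith

/-- If a form is close to `β` times the square of the projection to `σ / √n`, then its maximizer is
nearly parallel to `σ`. -/
theorem abs_mul_one_sub_le_of_isTopVector (hn : 1 ≤ n) {D : Matrix (Fin n) (Fin n) ℝ} {β E : ℝ}
    {σ : TypeAssignment n}
    (hD : ∀ y : Fin n → ℝ, ∑ u, y u ^ 2 = 1 →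
      |quadForm D y - β * ((∑ u, ((σ u : ℤ) : ℝ) * y u) ^ 2 / n)| ≤ E)
    {x : EuclideanSpace ℝ (Fin n)} (hx : IsTopVector D x) :
    |β| * (1 - (∑ u, ((σ u : ℤ) : ℝ) * x u) ^ 2 / n) ≤ 2 * E := by
  have hn0 : (0 : ℝ) < n := by exact_mod_cast hn
  have hσ : ∀ u, ((σ u : ℤ) : ℝ) ^ 2 = 1 := fun u => by rw [sq, units_cast_mul_self]
  set s : Fin n → ℝ := fun u => ((σ u : ℤ) : ℝ) / √n
  have hs : ∑ u, s u ^ 2 = 1 := by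
    simp only [s, div_pow, hσ, Real.sq_sqrt hn0.le]
    simp [hn0.ne']
  have hσs : (∑ u, ((σ u : ℤ) : ℝ) * s u) ^ 2 / n = 1 := by
    simp only [s, mul_div_assoc', units_cast_mul_self]
    rw [sum_const, card_univ, Fintype.card_fin, nsmul_eq_mul, mul_pow, div_pow,
      Real.sq_sqrt hn0.le]
    field_simp
  have hxnorm : ∑ u, x u ^ 2 = 1 := by
    rw [← EuclideanSpace.real_norm_sq_eq, hx.1, one_pow]
  have h1 := hD s hs
  have h2 := hD x.ofLp hxnorm
  have h3 := hx.2 (WithLp.toLp 2 s) (by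
    rw [← sq_eq_sq₀ (norm_nonneg _) zero_le_one, EuclideanSpace.real_norm_sq_eq, one_pow]
    exact hs)
  change |quadForm D s| ≤ |quadForm D x.ofLp| at h3
  rw [hσs, mul_one] at h1
  set T := (∑ u, ((σ u : ℤ) : ℝ) * x u) ^ 2 / (n : ℝ)
  have hT : 0 ≤ T := by positivity
  -- At σ/√n the form is within E of β, at x within E of βT; maximality of x joins the two bounds.
  have h4 : |β| ≤ |quadForm D s| + |quadForm D s - β| := by
    have := abs_sub_abs_le_abs_sub β (quadForm D s)
    rw [abs_sub_comm β] at this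
    linarith
  have h5 : |quadForm D x.ofLp| ≤ |β| * T + |quadForm D x.ofLp - β * T| := by
    have := abs_sub_abs_le_abs_sub (quadForm D x.ofLp) (β * T)
    rw [abs_mul, abs_of_nonneg hT] at this
    linarith
  linarith

/-- Coordinates where the signs differ contribute nonpositively, so Cauchy–Schwarz is needed only on
the agreeing ones. -/
theorem sq_sum_le_card_agree {σ s : TypeAssignment n} {x : EuclideanSpace ℝ (Fin n)}
    (hs : IsSignVector x s) (hx : ∑ u, x u ^ 2 = 1) (h0 : 0 ≤ ∑ u, ((σ u : ℤ) : ℝ) * x u) :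
    (∑ u, ((σ u : ℤ) : ℝ) * x u) ^ 2 ≤ #{u | σ u = s u} := by
  have h1 : ∑ u, ((σ u : ℤ) : ℝ) * x u ≤ ∑ u with σ u = s u, |x u| := by
    rw [sum_filter]
    refine sum_le_sum fun u _ => ?_
    obtain ⟨hp, hm⟩ := hs u
    split_ifs with h
    · refine (le_abs_self _).trans ?_
      rw [abs_mul, abs_units_cast, one_mul]
    · rcases Int.units_eq_one_or (σ u) with h1 | h1
      · rw [h1] at h ⊢
        have : ¬ 0 < x u := fun h' => h (hp h').symm
        simpa using this
      · rw [h1] at h ⊢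
        have : ¬ x u < 0 := fun h' => h (hm h').symm
        simpa using this
  have h2 := sq_sum_le_card_mul_sum_sq (s := univ.filter fun u => σ u = s u) (f := fun u => |x u|)
  calc (∑ u, ((σ u : ℤ) : ℝ) * x u) ^ 2 ≤ (∑ u with σ u = s u, |x u|) ^ 2 :=
        pow_le_pow_left₀ h0 h1 2
    _ ≤ #{u | σ u = s u} * ∑ u with σ u = s u, |x u| ^ 2 := h2
    _ ≤ #{u | σ u = s u} * 1 := by
        refine mul_le_mul_of_nonneg_left ?_ (Nat.cast_nonneg _)
        rw [← hx]
        simp only [sq_abs]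
        exact sum_le_sum_of_subset_of_nonneg (filter_subset _ _) fun _ _ _ => sq_nonneg _
    _ = _ := mul_one _

theorem card_agree_add_hammingDist (σ s : TypeAssignment n) :
    (#{u | σ u = s u} : ℝ) + hammingDist σ s = n := by
  have := card_filter_add_card_filter_not (s := (univ : Finset (Fin n))) (fun u => σ u = s u)
  rw [card_univ, Fintype.card_fin] at this
  rw [hammingDist]
  exact_mod_cast this

theorem overlap_ge_of_isSignVector (hn : 1 ≤ n) {σ s : TypeAssignment n}
    {x : EuclideanSpace ℝ (Fin n)} (hs : IsSignVector x s) (hx : ∑ u, x u ^ 2 = 1) {δ : ℝ}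
    (h : 1 - δ ≤ (∑ u, ((σ u : ℤ) : ℝ) * x u) ^ 2 / n) : 1 / 2 - δ ≤ overlap σ s := by
  have hn0 : (0 : ℝ) < n := by exact_mod_cast hn
  rw [le_div_iff₀ hn0] at h
  have key : min (hammingDist σ s : ℝ) (hammingDist σ (-s) : ℝ) ≤ δ * n := by
    rcases le_total 0 (∑ u, ((σ u : ℤ) : ℝ) * x u) with h0 | h0
    · refine (min_le_left _ _).trans ?_
      have h1 := sq_sum_le_card_agree hs hx h0
      have h2 := card_agree_add_hammingDist σ s
      linarith
    · refine (min_le_right _ _).trans ?_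
      have h3 : ∑ u, (((-σ) u : ℤ) : ℝ) * x u = -∑ u, ((σ u : ℤ) : ℝ) * x u := by
        simp
      have h1 := sq_sum_le_card_agree (σ := -σ) hs hx (by rw [h3]; linarith)
      have h2 := card_agree_add_hammingDist σ (-s)
      have h4 : ∀ u, (-σ) u = s u ↔ σ u = (-s) u := fun u => by
        rw [Pi.neg_apply, Pi.neg_apply, neg_eq_iff_eq_neg]
      rw [h3, neg_sq] at h1
      simp only [h4] at h1
      linarith
  rw [overlap]
  have : 1 / (n : ℝ) * min (hammingDist σ s : ℝ) (hammingDist σ (-s) : ℝ) ≤ δ := by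
    rw [one_div, inv_mul_le_iff₀ hn0]
    linarith
  linarith

end QuadraticForms

/-! ### The noise bound and the effect of pruning. -/

section Norm

variable {n : ℕ} {L : Type}

theorem edgeLabel_prune (t : ℝ) (X : LabeledGraph n L) (u v : Fin n) :
    edgeLabel (prune t X) u v =
      if u ∈ highDegree t X ∨ v ∈ highDegree t X then none else edgeLabel X u v := by
  simp only [highDegree, mem_filter, mem_univ, true_and]
  rcases lt_trichotomy u v with h | h | h
  · simp only [edgeLabel, h, dite_true, prune]
  · subst h
    simp [edgeLabel]
  · simp only [edgeLabel, h, h.not_gt, dite_true, dite_false, prune]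
    simp only [or_comm]

theorem weightMatrix_prune_apply (w : L → ℝ) (t : ℝ) (X : LabeledGraph n L) (u v : Fin n) :
    weightMatrix w (prune t X) u v =
      if u ∈ highDegree t X ∨ v ∈ highDegree t X then 0 else pairWeight w (edgeLabel X u v) := by
  rw [weightMatrix, Matrix.of_apply, edgeLabel_prune]
  split_ifs <;> rfl

theorem abs_pairWeight_le {w : L → ℝ} (hw : ∀ ℓ, |w ℓ| ≤ 1) (o : Option L) :
    |pairWeight w o| ≤ edgeInd o := by
  cases o with
  | none => simp [pairWeight, edgeInd]
  | some ℓ => exact hw ℓ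

variable [Fintype L] {p q a b : ℝ} {μ ν w : L → ℝ}

theorem alpha_add_beta (a b : ℝ) (μ ν w : L → ℝ) :
    alpha a b μ ν w + beta a b μ ν w = a * ∑ ℓ, w ℓ * μ ℓ := by
  rw [alpha, beta, ← mul_add, ← sum_add_distrib, mul_sum, mul_sum]
  exact sum_congr rfl fun _ _ => by ring

theorem alpha_sub_beta (a b : ℝ) (μ ν w : L → ℝ) :
    alpha a b μ ν w - beta a b μ ν w = b * ∑ ℓ, w ℓ * ν ℓ := by
  rw [alpha, beta, ← mul_sub, ← sum_sub_distrib, mul_sum, mul_sum]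
  exact sum_congr rfl fun _ _ => by ring

/-- The entries of the expected weight matrix. -/
def expectedWeight (a b : ℝ) (μ ν w : L → ℝ) (σ : TypeAssignment n) (u v : Fin n) : ℝ :=
  (alpha a b μ ν w + beta a b μ ν w * (((σ u : ℤ) : ℝ) * ((σ v : ℤ) : ℝ))) / n

theorem meanWeight_eq (a b : ℝ) (μ ν w : L → ℝ) (σ : TypeAssignment n) (e : VertexPair n) :
    meanWeight (a / n) (b / n) μ ν w σ e = expectedWeight a b μ ν w σ e.1.1 e.1.2 := by
  rw [meanWeight, sum_pairMass_mul_pairWeight, div_mul_eq_mul_div, div_mul_eq_mul_div,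
    ← alpha_add_beta a b μ ν w, ← alpha_sub_beta a b μ ν w, expectedWeight]
  rcases Int.units_eq_one_or (σ e.1.1) with h | h <;>
    rcases Int.units_eq_one_or (σ e.1.2) with h' | h' <;> simp [h, h'] <;> ring

theorem expectedWeight_comm (a b : ℝ) (μ ν w : L → ℝ) (σ : TypeAssignment n) (u v : Fin n) :
    expectedWeight a b μ ν w σ u v = expectedWeight a b μ ν w σ v u := by
  rw [expectedWeight, expectedWeight, mul_comm ((σ u : ℤ) : ℝ)]

theorem abs_sum_mul_le_one (hw : ∀ ℓ, |w ℓ| ≤ 1) (hμ : μ ∈ stdSimplex ℝ L) :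
    |∑ ℓ, w ℓ * μ ℓ| ≤ 1 := by
  rw [← hμ.2]
  refine (abs_sum_le_sum_abs _ _).trans (sum_le_sum fun ℓ _ => ?_)
  rw [abs_mul, abs_of_nonneg (hμ.1 ℓ)]
  exact mul_le_of_le_one_left (hμ.1 ℓ) (hw ℓ)

/-- |α| + |β| is the larger of |α + β| and |α - β|, which are at most a and b. -/
theorem abs_alpha_add_abs_beta_le (hb : 0 ≤ b) (hba : b ≤ a) (hμ : μ ∈ stdSimplex ℝ L)
    (hν : ν ∈ stdSimplex ℝ L) (hw : ∀ ℓ, |w ℓ| ≤ 1) :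
    |alpha a b μ ν w| + |beta a b μ ν w| ≤ a := by
  have h1 := abs_le.1 (abs_sum_mul_le_one hw hμ)
  have h2 := abs_le.1 (abs_sum_mul_le_one hw hν)
  have h3 := alpha_add_beta a b μ ν w
  have h4 := alpha_sub_beta a b μ ν w
  rcases abs_cases (alpha a b μ ν w) with h5 | h5 <;>
    rcases abs_cases (beta a b μ ν w) with h6 | h6 <;> nlinarith

theorem abs_expectedWeight_le (hb : 0 ≤ b) (hba : b ≤ a) (hμ : μ ∈ stdSimplex ℝ L)
    (hν : ν ∈ stdSimplex ℝ L) (hw : ∀ ℓ, |w ℓ| ≤ 1) (σ : TypeAssignment n) (u v : Fin n) :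
    |expectedWeight a b μ ν w σ u v| ≤ a / n := by
  rw [expectedWeight, abs_div, Nat.abs_cast]
  refine div_le_div_of_nonneg_right ?_ (Nat.cast_nonneg n)
  refine (abs_add_le _ _).trans ?_
  rw [abs_mul, abs_mul, abs_units_cast, abs_units_cast, mul_one, mul_one]
  exact abs_alpha_add_abs_beta_le hb hba hμ hν hw

/-- The centered weight matrix on the vertices of moderate degree. -/
def deviationMatrix (t a b : ℝ) (μ ν w : L → ℝ) (ω : TypeAssignment n × LabeledGraph n L) :
    Matrix (Fin n) (Fin n) ℝ :=
  Matrix.of fun u v => if u ∈ highDegree t ω.2 ∨ v ∈ highDegree t ω.2 then 0 else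
    pairWeight w (edgeLabel ω.2 u v) - expectedWeight a b μ ν w ω.1 u v

theorem isSymm_deviationMatrix (t a b : ℝ) (μ ν w : L → ℝ)
    (ω : TypeAssignment n × LabeledGraph n L) : (deviationMatrix t a b μ ν w ω).IsSymm := by
  refine Matrix.IsSymm.ext fun u v => ?_
  simp only [deviationMatrix, Matrix.of_apply]
  rw [edgeLabel_comm, expectedWeight_comm]
  simp only [or_comm]

/-- The light part gives 76r and the observed weight on heavy pairs 1754r. The mean on heavy pairs
gives at most r, because n|y_u y_v| > 4r there lets |y_u y_v| a/n be absorbed into (y_u y_v)². -/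
theorem abs_sum_vertexPair_le {n : ℕ} {a b : ℝ} {μ ν w : L → ℝ} (hn : 1 ≤ n) (hb : 0 ≤ b)
    (hba : b ≤ a) (hμ : μ ∈ stdSimplex ℝ L)
    (hν : ν ∈ stdSimplex ℝ L) (hw : ∀ ℓ, |w ℓ| ≤ 1) {h : ℕ} (hp : a ≤ 2 * ((2 : ℝ) ^ h) ^ 2)
    {ω : TypeAssignment n × LabeledGraph n L} (hX : Discrepancy (a / n) ω.2)
    {y : Fin n → ℝ} (hy : ∑ u, y u ^ 2 ≤ 1)
    (hlight : |lightForm (a / n) (b / n) μ ν w (2 ^ h) ω y| ≤ 76 * 2 ^ h)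
    (hdeg : ∀ u, y u ≠ 0 → ((graph ω.2).degree u : ℝ) ≤ 2 * ((2 : ℝ) ^ h) ^ 2) :
    |∑ e : VertexPair n, y e.1.1 * y e.1.2 *
      (pairWeight w (ω.2 e) - meanWeight (a / n) (b / n) μ ν w ω.1 e)| ≤ 1831 * 2 ^ h := by
  have hn0 : (0 : ℝ) < n := by exact_mod_cast hn
  have ha : 0 ≤ a := hb.trans hba
  set r : ℝ := 2 ^ h with hrdef
  have hr : 0 < r := by positivity
  set t : Fin n → ℝ := fun u => √n * |y u|
  have hprod : ∀ u v, t u * t v = n * |y u * y v| := fun u v => by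
    simp only [t, abs_mul]
    rw [mul_mul_mul_comm, Real.mul_self_sqrt hn0.le]
  have hheavy := heavy_sum_le hn hX (h := h) (div_nonneg ha hn0.le)
    (by rw [mul_div_cancel₀ _ hn0.ne']; exact hp) (t := t) (fun u => by positivity)
    (by
      simp only [t, mul_pow, sq_abs, Real.sq_sqrt hn0.le, ← mul_sum]
      exact mul_le_of_le_one_right hn0.le hy)
    (fun u hu => hdeg u fun h0 => hu (by simp [t, h0]))
  simp only [hprod] at hheavy
  have hpt : ∀ e : VertexPair n, |y e.1.1 * y e.1.2 *
      (pairWeight w (ω.2 e) - meanWeight (a / n) (b / n) μ ν w ω.1 e) -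
      (if n * |y e.1.1 * y e.1.2| ≤ 4 * r then y e.1.1 * y e.1.2 *
        (pairWeight w (ω.2 e) - meanWeight (a / n) (b / n) μ ν w ω.1 e) else 0)| ≤
      (if 4 * r < n * |y e.1.1 * y e.1.2| then n * |y e.1.1 * y e.1.2| * edgeInd (ω.2 e)
        else 0) / n + a / (4 * r) * (y e.1.1 * y e.1.2) ^ 2 := by
    intro e
    split_ifs with h1 h2 h2
    · exact absurd h1 h2.not_ge
    · rw [sub_self, abs_zero, zero_div, zero_add]
      positivity
    · have h3 := abs_pairWeight_le hw (ω.2 e)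
      have h4 : |meanWeight (a / n) (b / n) μ ν w ω.1 e| ≤ a / n := by
        rw [meanWeight_eq]
        exact abs_expectedWeight_le hb hba hμ hν hw _ _ _
      have h5 : |y e.1.1 * y e.1.2| * (a / n) ≤ a / (4 * r) * (y e.1.1 * y e.1.2) ^ 2 := by
        rw [← sq_abs (y e.1.1 * y e.1.2)]
        set c := |y e.1.1 * y e.1.2|
        have hc : 0 ≤ c := abs_nonneg _
        rw [mul_div_assoc', div_mul_eq_mul_div, div_le_div_iff₀ hn0 (by positivity)]
        have := mul_le_mul_of_nonneg_left h2.le (mul_nonneg hc ha)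
        linarith
      rw [sub_zero, abs_mul]
      calc |y e.1.1 * y e.1.2| *
            |pairWeight w (ω.2 e) - meanWeight (a / n) (b / n) μ ν w ω.1 e|
          ≤ |y e.1.1 * y e.1.2| * (edgeInd (ω.2 e) + a / n) :=
            mul_le_mul_of_nonneg_left ((abs_sub _ _).trans (add_le_add h3 h4)) (abs_nonneg _)
        _ ≤ _ := by
            rw [mul_add]
            refine add_le_add (le_of_eq ?_) h5
            field_simp
    · exact absurd (not_lt.1 h2) h1
  have hsum : ∑ e : VertexPair n, ((if 4 * r < n * |y e.1.1 * y e.1.2| then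
      n * |y e.1.1 * y e.1.2| * edgeInd (ω.2 e) else 0) / n +
        a / (4 * r) * (y e.1.1 * y e.1.2) ^ 2) ≤ 1755 * r := by
    rw [sum_add_distrib, ← sum_div, ← mul_sum]
    have h1 : ∑ e : VertexPair n, (y e.1.1 * y e.1.2) ^ 2 ≤ 1 :=
      (sum_vertexPair_sq_le y).trans (pow_le_one₀ (sum_nonneg fun _ _ => sq_nonneg _) hy)
    have h2 : a / (4 * r) ≤ r := by
      rw [div_le_iff₀ (by positivity)]
      nlinarith
    calc _ ≤ 1754 * (r * n) / n + a / (4 * r) * 1 := by gcongr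
      _ ≤ 1754 * (r * n) / n + r := by linarith
      _ = 1755 * r := by field_simp; ring
  have hdiff := (abs_sum_le_sum_abs _ _).trans
    ((sum_le_sum fun e (_ : e ∈ univ) => hpt e).trans hsum)
  rw [sum_sub_distrib] at hdiff
  have := abs_sub_abs_le_abs_sub (∑ e : VertexPair n, y e.1.1 * y e.1.2 *
      (pairWeight w (ω.2 e) - meanWeight (a / n) (b / n) μ ν w ω.1 e))
      (lightForm (a / n) (b / n) μ ν w r ω y)
  rw [lightForm] at this hlight
  linarith

/-- The centered weight matrix on the vertices of moderate degree has small norm. -/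
theorem abs_quadForm_deviationMatrix_le {n : ℕ} {a b : ℝ} {μ ν w : L → ℝ} (hn : 1 ≤ n)
    (hb : 0 ≤ b) (hba : b ≤ a) (han : a ≤ n) (hμ : μ ∈ stdSimplex ℝ L)
    (hν : ν ∈ stdSimplex ℝ L) (hw : ∀ ℓ, |w ℓ| ≤ 1) {h : ℕ} (hp : a ≤ 2 * ((2 : ℝ) ^ h) ^ 2)
    {t : ℝ} (ht : t ≤ 2 * ((2 : ℝ) ^ h) ^ 2)
    {ω : TypeAssignment n × LabeledGraph n L} (hX : Discrepancy (a / n) ω.2)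
    (hlight : LightBound (a / n) (b / n) μ ν w (2 ^ h) ω)
    (y : Fin n → ℝ) (hy : ∑ u, y u ^ 2 ≤ 1) :
    |quadForm (deviationMatrix t a b μ ν w ω) y| ≤ 7326 * 2 ^ h := by
  have hn0 : (0 : ℝ) < n := by exact_mod_cast hn
  have hr : (1 : ℝ) ≤ 2 ^ h := one_le_pow₀ (by norm_num)
  refine (abs_quadForm_le_of_net hn (isSymm_deviationMatrix t a b μ ν w ω)
    (c := 3663 * 2 ^ h) ?_ y hy).trans (by linarith)
  intro z hz
  -- Deleting vertices amounts to zeroing coordinates, which sends lattice points of the ball to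
  -- lattice points of the ball. Hence the uniform light bound applies although the deleted set
  -- depends on the graph.
  set z' : Fin n → ℤ := fun u => if u ∈ highDegree t ω.2 then 0 else z u
  have hz' : ∑ u, (z' u : ℝ) ^ 2 ≤ 16 * n := by
    refine (sum_le_sum fun u _ => ?_).trans hz
    simp only [z']
    split_ifs
    · simpa using sq_nonneg (z u : ℝ)
    · exact le_rfl
  have hy' : ∑ u, netVector z' u ^ 2 ≤ 1 := by
    rw [sum_netVector_sq hn]
    exact (div_le_one (by positivity)).2 hz'
  have hdeg : ∀ u, netVector z' u ≠ 0 →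
      ((graph ω.2).degree u : ℝ) ≤ 2 * ((2 : ℝ) ^ h) ^ 2 := by
    intro u hu
    have : u ∉ highDegree t ω.2 := fun hmem => hu (by simp [netVector, z', hmem])
    simp only [highDegree, mem_filter, mem_univ, true_and, not_lt] at this
    exact this.trans ht
  have hpair := abs_sum_vertexPair_le hn hb hba hμ hν hw hp hX hy' (hlight z' hz') hdeg
  have hform : quadForm (deviationMatrix t a b μ ν w ω) (netVector z) =
      ∑ u, ∑ v, netVector z' u * netVector z' v *
        (pairWeight w (edgeLabel ω.2 u v) - expectedWeight a b μ ν w ω.1 u v) := by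
    rw [quadForm_eq_sum]
    refine sum_congr rfl fun u _ => sum_congr rfl fun v _ => ?_
    by_cases hu : u ∈ highDegree t ω.2 <;> by_cases hv : v ∈ highDegree t ω.2 <;>
      simp [deviationMatrix, netVector, z', hu, hv]
  rw [hform, sum_sum_eq_sum_vertexPair]
  simp only [edgeLabel_pair, edgeLabel_pair_symm, edgeLabel_self]
  have h1 : ∑ e : VertexPair n, (netVector z' e.1.1 * netVector z' e.1.2 *
        (pairWeight w (ω.2 e) - expectedWeight a b μ ν w ω.1 e.1.1 e.1.2) +
      netVector z' e.1.2 * netVector z' e.1.1 *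
        (pairWeight w (ω.2 e) - expectedWeight a b μ ν w ω.1 e.1.2 e.1.1)) =
      2 * ∑ e : VertexPair n, netVector z' e.1.1 * netVector z' e.1.2 *
        (pairWeight w (ω.2 e) - meanWeight (a / n) (b / n) μ ν w ω.1 e) := by
    rw [mul_sum]
    refine sum_congr rfl fun e _ => ?_
    rw [meanWeight_eq, expectedWeight_comm a b μ ν w ω.1 e.1.2]
    ring
  -- The diagonal has weight zero but nonzero `expectedWeight`; each entry is at most a/n ≤ 1 in
  -- absolute value.
  have h2 : |∑ u, netVector z' u * netVector z' u *
      (pairWeight w none - expectedWeight a b μ ν w ω.1 u u)| ≤ 1 := by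
    refine (abs_sum_le_sum_abs _ _).trans ((sum_le_sum fun u _ => ?_).trans hy')
    have h3 := abs_expectedWeight_le hb hba hμ hν hw ω.1 u u
    have h4 : a / n ≤ 1 := (div_le_one hn0).2 han
    rw [← sq, abs_mul, abs_of_nonneg (sq_nonneg _)]
    refine mul_le_of_le_one_right (sq_nonneg _) ?_
    simp only [pairWeight, Option.elim, zero_sub, abs_neg]
    linarith
  rw [h1]
  refine (abs_add_le _ _).trans ?_
  rw [abs_mul, abs_two]
  linarith

/-- Factor the difference of squares: the difference of the two sums lives on `B`, and their sum has
square at most 4n. -/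
theorem sq_diff_sum_le {n : ℕ} {s : Fin n → ℝ} (hs : ∀ u, |s u| = 1) (B : Finset (Fin n))
    {y : Fin n → ℝ} (hy : ∑ u, y u ^ 2 ≤ 1) :
    ((∑ u, s u * y u) ^ 2 - (∑ u, s u * (if u ∈ B then 0 else y u)) ^ 2) ^ 2 ≤ 4 * n * #B := by
  have hsq : ∀ u, s u ^ 2 = 1 := fun u => by rw [← sq_abs, hs, one_pow]
  have hCS : ∀ A : Finset (Fin n), (∑ u ∈ A, s u * y u) ^ 2 ≤ #A := by
    intro A
    calc (∑ u ∈ A, s u * y u) ^ 2 ≤ #A * ∑ u ∈ A, (s u * y u) ^ 2 := sq_sum_le_card_mul_sum_sq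
      _ ≤ #A * 1 := by
          refine mul_le_mul_of_nonneg_left (le_trans ?_ hy) (Nat.cast_nonneg _)
          simp only [mul_pow, hsq, one_mul]
          exact sum_le_sum_of_subset_of_nonneg (subset_univ _) fun _ _ _ => sq_nonneg _
      _ = _ := mul_one _
  have h1 : ∑ u, s u * (if u ∈ B then 0 else y u) = ∑ u ∈ Bᶜ, s u * y u := by
    rw [compl_eq_univ_sdiff, ← filter_notMem_eq_sdiff, sum_filter]
    refine sum_congr rfl fun u _ => ?_
    by_cases hu : u ∈ B <;> simp [hu]
  have h2 : ∑ u, s u * y u = ∑ u ∈ B, s u * y u + ∑ u ∈ Bᶜ, s u * y u :=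
    (sum_add_sum_compl B _).symm
  have h3 := hCS B
  have h4 := hCS univ
  have h5 := hCS Bᶜ
  have h6 : (#Bᶜ : ℝ) ≤ n := by
    have := card_le_univ Bᶜ
    rw [Fintype.card_fin] at this
    exact_mod_cast this
  rw [card_univ, Fintype.card_fin] at h4
  rw [h1]
  set P := ∑ u, s u * y u
  set Q := ∑ u ∈ Bᶜ, s u * y u
  have h7 : P - Q = ∑ u ∈ B, s u * y u := by linarith
  rw [sq_sub_sq, mul_pow, h7]
  have h8 : (P + Q) ^ 2 ≤ 4 * n := by nlinarith [sq_nonneg (P - Q)]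
  exact mul_le_mul h8 h3 (sq_nonneg _) (by positivity)

theorem sum_sum_expectedWeight (a b : ℝ) (μ ν w : L → ℝ) (σ : TypeAssignment n)
    (y : Fin n → ℝ) :
    ∑ u, ∑ v, y u * y v * expectedWeight a b μ ν w σ u v =
      (alpha a b μ ν w * (∑ u, 1 * y u) ^ 2 +
        beta a b μ ν w * (∑ u, ((σ u : ℤ) : ℝ) * y u) ^ 2) / n := by
  rw [sq, sq, sum_mul_sum, sum_mul_sum, mul_sum, mul_sum, ← sum_add_distrib, sum_div]
  refine sum_congr rfl fun u _ => ?_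
  rw [mul_sum, mul_sum, ← sum_add_distrib, sum_div]
  refine sum_congr rfl fun v _ => ?_
  rw [expectedWeight]
  ring

/-- Pruning restricts the mean of the weights to the surviving vertices, but the subtracted (α/n)J
is not restricted, so the α parts cancel only up to a difference of squares. -/
theorem quadForm_centeredMatrix (a b : ℝ) (μ ν w : L → ℝ)
    (ω : TypeAssignment n × LabeledGraph n L) (y : Fin n → ℝ) {y' : Fin n → ℝ}
    (hy' : ∀ u, y' u = if u ∈ highDegree (3 / 2 * ((a + b) / 2)) ω.2 then 0 else y u) :
    quadForm (centeredMatrix a b μ ν w ω.2) y =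
      quadForm (deviationMatrix (3 / 2 * ((a + b) / 2)) a b μ ν w ω) y +
        (alpha a b μ ν w * ((∑ u, 1 * y' u) ^ 2 - (∑ u, 1 * y u) ^ 2) +
          beta a b μ ν w * (∑ u, ((ω.1 u : ℤ) : ℝ) * y' u) ^ 2) / n := by
  have h1 : (alpha a b μ ν w * ((∑ u, 1 * y' u) ^ 2 - (∑ u, 1 * y u) ^ 2) +
      beta a b μ ν w * (∑ u, ((ω.1 u : ℤ) : ℝ) * y' u) ^ 2) / n =
      ∑ u, ∑ v, y' u * y' v * expectedWeight a b μ ν w ω.1 u v -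
        alpha a b μ ν w / n * (∑ u, 1 * y u) ^ 2 := by
    rw [sum_sum_expectedWeight]
    ring
  have h2 : alpha a b μ ν w / n * (∑ u, 1 * y u) ^ 2 =
      ∑ u, ∑ v, alpha a b μ ν w / n * (y u * y v) := by
    rw [sq, sum_mul_sum, mul_sum]
    simp only [one_mul, mul_sum]
  rw [h1, h2, quadForm_eq_sum, quadForm_eq_sum, ← sum_sub_distrib, ← sum_add_distrib]
  refine sum_congr rfl fun u _ => ?_
  rw [← sum_sub_distrib, ← sum_add_distrib]
  refine sum_congr rfl fun v _ => ?_
  rw [centeredMatrix, Matrix.sub_apply, weightMatrix_prune_apply, Matrix.smul_apply,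
    Matrix.of_apply, deviationMatrix, Matrix.of_apply, smul_eq_mul, mul_one, hy' u, hy' v]
  by_cases hu : u ∈ highDegree (3 / 2 * ((a + b) / 2)) ω.2 <;>
    by_cases hv : v ∈ highDegree (3 / 2 * ((a + b) / 2)) ω.2 <;> simp [hu, hv] <;> ring

/-- The noise contributes 7326r. Restricting the mean costs 44r: with at most 110n/d deleted
vertices, the squared error is at most 16 · 110 · (rn)² ≤ (44rn)². -/
theorem abs_quadForm_centeredMatrix_sub_le {n : ℕ} {a b : ℝ} {μ ν w : L → ℝ} (hn : 1 ≤ n)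
    (hb : 0 < b) (hba : b ≤ a) (han : a ≤ n) (hμ : μ ∈ stdSimplex ℝ L)
    (hν : ν ∈ stdSimplex ℝ L) (hw : ∀ ℓ, |w ℓ| ≤ 1) {h : ℕ}
    (hp : (a + b) / 2 ≤ ((2 : ℝ) ^ h) ^ 2)
    {ω : TypeAssignment n × LabeledGraph n L} (hX : Discrepancy (a / n) ω.2)
    (hlight : LightBound (a / n) (b / n) μ ν w (2 ^ h) ω)
    (hhigh : #(highDegree (3 / 2 * ((a + b) / 2)) ω.2) * ((a + b) / 2) ≤ 110 * n)
    (y : Fin n → ℝ) (hy : ∑ u, y u ^ 2 ≤ 1) :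
    |quadForm (centeredMatrix a b μ ν w ω.2) y -
      beta a b μ ν w * ((∑ u, ((ω.1 u : ℤ) : ℝ) * y u) ^ 2 / n)| ≤ 7370 * 2 ^ h := by
  have hn0 : (0 : ℝ) < n := by exact_mod_cast hn
  set r : ℝ := 2 ^ h with hrdef
  have hr : 0 < r := by positivity
  set B := highDegree (3 / 2 * ((a + b) / 2)) ω.2
  have h1 := abs_quadForm_deviationMatrix_le hn hb.le hba han hμ hν hw (h := h) (by linarith)
    (t := 3 / 2 * ((a + b) / 2)) (by nlinarith) hX hlight y hy
  rw [quadForm_centeredMatrix a b μ ν w ω y fun u => rfl]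
  have key : ∀ s : Fin n → ℝ, (∀ u, |s u| = 1) →
      |(∑ u, s u * y u) ^ 2 - (∑ u, s u * (if u ∈ B then 0 else y u)) ^ 2| * a ≤ 44 * r * n := by
    intro s hs
    have h2 := sq_diff_sum_le hs B hy
    refine abs_le_of_sq_le_sq' ?_ (by positivity) |>.2
    rw [mul_pow, sq_abs]
    have ha2 : a ^ 2 ≤ (2 * ((a + b) / 2)) ^ 2 := pow_le_pow_left₀ (by linarith) (by linarith) 2
    have hB : 0 ≤ #B * ((a + b) / 2) := mul_nonneg (Nat.cast_nonneg _) (by linarith)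
    calc _ ≤ 4 * n * #B * (2 * ((a + b) / 2)) ^ 2 := by gcongr
      _ = 16 * n * ((a + b) / 2) * (#B * ((a + b) / 2)) := by ring
      _ ≤ 16 * n * r ^ 2 * (110 * n) := by gcongr
      _ ≤ (44 * r * n) ^ 2 := by nlinarith [sq_nonneg (r * n)]
  have hα := key (fun _ => 1) (by simp)
  have hβ := key (fun u => ((ω.1 u : ℤ) : ℝ)) fun u => abs_units_cast _
  have hab := abs_alpha_add_abs_beta_le hb.le hba hμ hν hw
  set A := (∑ u, 1 * y u) ^ 2 - (∑ u, 1 * (if u ∈ B then 0 else y u)) ^ 2 with hA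
  set S := (∑ u, ((ω.1 u : ℤ) : ℝ) * y u) ^ 2 -
    (∑ u, ((ω.1 u : ℤ) : ℝ) * (if u ∈ B then 0 else y u)) ^ 2 with hS
  have hrew : quadForm (deviationMatrix (3 / 2 * ((a + b) / 2)) a b μ ν w ω) y +
        (alpha a b μ ν w * ((∑ u, 1 * (if u ∈ B then 0 else y u)) ^ 2 - (∑ u, 1 * y u) ^ 2) +
          beta a b μ ν w * (∑ u, ((ω.1 u : ℤ) : ℝ) * (if u ∈ B then 0 else y u)) ^ 2) / n -
      beta a b μ ν w * ((∑ u, ((ω.1 u : ℤ) : ℝ) * y u) ^ 2 / n) =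
      quadForm (deviationMatrix (3 / 2 * ((a + b) / 2)) a b μ ν w ω) y +
        -((alpha a b μ ν w * A + beta a b μ ν w * S) / n) := by
    rw [hA, hS]
    ring
  rw [hrew]
  refine (abs_add_le _ _).trans ?_
  have ha0 : 0 < a := hb.trans_le hba
  have h3 : |-((alpha a b μ ν w * A + beta a b μ ν w * S) / n)| ≤ 44 * r := by
    rw [abs_neg, abs_div, Nat.abs_cast, div_le_iff₀ hn0]
    refine (abs_add_le _ _).trans ?_
    rw [abs_mul, abs_mul]
    refine le_of_mul_le_mul_right ?_ ha0
    calc (|alpha a b μ ν w| * |A| + |beta a b μ ν w| * |S|) * a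
        = |alpha a b μ ν w| * (|A| * a) + |beta a b μ ν w| * (|S| * a) := by ring
      _ ≤ |alpha a b μ ν w| * (44 * r * n) + |beta a b μ ν w| * (44 * r * n) := by gcongr
      _ = (|alpha a b μ ν w| + |beta a b μ ν w|) * (44 * r * n) := by ring
      _ ≤ a * (44 * r * n) := by gcongr
      _ = 44 * r * n * a := by ring
  linarith

end Norm

/-! ### Assembly of the probabilistic and spectral bounds; the optimal weight. -/

section Main

variable {L : Type} [Fintype L] {a b : ℝ} {μ ν w : L → ℝ}

/-- A power of two in place of √d lets the dyadic levels be compared with it through integer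
exponents. -/
theorem exists_two_pow_near_sqrt {d : ℝ} (hd : 1 ≤ d) :
    ∃ h : ℕ, d ≤ ((2 : ℝ) ^ h) ^ 2 ∧ ((2 : ℝ) ^ h) ^ 2 ≤ 4 * d := by
  obtain ⟨k, h1, h2⟩ := exists_nat_pow_near (x := √d) (Real.one_le_sqrt.2 hd)
    (by norm_num : (1 : ℝ) < 2)
  have h3 := Real.sq_sqrt (by linarith : 0 ≤ d)
  have h4 : (0 : ℝ) < 2 ^ k := by positivity
  refine ⟨k + 1, ?_, ?_⟩
  · rw [← h3]
    exact pow_le_pow_left₀ (Real.sqrt_nonneg _) h2.le 2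
  · have h5 : (2 : ℝ) ^ (k + 1) = 2 ^ k * 2 := pow_succ _ _
    rw [h5, ← h3]
    nlinarith

theorem spectralSucceeds_of_lt (hb : 1 < b) (hba : b < a) (hμ : μ ∈ stdSimplex ℝ L)
    (hν : ν ∈ stdSimplex ℝ L) (hw : ∀ ℓ, w ℓ ∈ Set.Icc (-1 : ℝ) 1)
    (hβ : 2 * (16 * 7370) ^ 2 * (a + b) < beta a b μ ν w ^ 2) :
    SpectralSucceeds a b μ ν w := by
  have hw' : ∀ ℓ, |w ℓ| ≤ 1 := fun ℓ => abs_le.2 (hw ℓ)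
  obtain ⟨h, hh1, hh2⟩ := exists_two_pow_near_sqrt (d := (a + b) / 2) (by linarith)
  set r : ℝ := 2 ^ h with hrdef
  have hr : (1 : ℝ) ≤ r := one_le_pow₀ (by norm_num)
  -- From r² ≤ 4d = 2(a+b), which explains the constant in the hypothesis on β.
  have hβr : 16 * (7370 * r) < |beta a b μ ν w| := by
    refine lt_of_pow_lt_pow_left₀ 2 (abs_nonneg _) ?_
    rw [sq_abs]
    nlinarith
  refine ⟨1 / 4, by norm_num, ?_⟩
  set δ : ℕ → ℝ := fun n =>
    1 / n + (2 * Real.exp (-n) + (Real.exp (-n) + 2 * Real.exp (-(n / 200))))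
  have hadm : ∀ n : ℕ, 1 ≤ n → a ≤ n → Admissible (a / n) (b / n) μ ν := by
    intro n hn han
    have hn0 : (0 : ℝ) < n := by exact_mod_cast hn
    exact ⟨div_nonneg (by linarith) hn0.le, (div_le_one hn0).2 han, div_nonneg (by linarith) hn0.le,
      (div_le_one hn0).2 (by linarith), hμ, hν⟩
  have hlow : ∀ᶠ n : ℕ in Filter.atTop, 1 - δ n ≤ prob (n := n) (a / (n : ℝ)) (b / (n : ℝ)) μ ν
      {ω | ∀ s, IsSpectralOutput a b μ ν w ω.2 s → 1 / 4 ≤ overlap ω.1 s} := by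
    filter_upwards [Filter.eventually_ge_atTop 1, Filter.eventually_ge_atTop ⌈a⌉₊] with n hn han
    have han : a ≤ n := (Nat.le_ceil a).trans (by exact_mod_cast han)
    have hn0 : (0 : ℝ) < n := by exact_mod_cast hn
    have H := hadm n hn han
    have hqp : b / (n : ℝ) ≤ a / n := div_le_div_of_nonneg_right hba.le hn0.le
    have hd : n * (a / (n : ℝ) + b / n) = 2 * ((a + b) / 2) := by field_simp
    have hp : n * (a / (n : ℝ)) ≤ 2 * r ^ 2 := by
      rw [mul_div_cancel₀ _ hn0.ne']; linarith
    have h1 := prob_not_discrepancy_le (n := n) H hqp hn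
    have h2 := prob_not_lightBound_le (n := n) H hqp hn hw' hr hp
    have h3 := prob_highDegree_le (n := n) H hqp hd
    have h4 := prob_not_balanced_le (n := n) H
    have hcompl := prob_add_prob_compl H {ω : TypeAssignment n × LabeledGraph n L |
      ∀ s, IsSpectralOutput a b μ ν w ω.2 s → 1 / 4 ≤ overlap ω.1 s}
    have hbad := (prob_mono H (?_ : {ω : TypeAssignment n × LabeledGraph n L |
      ∀ s, IsSpectralOutput a b μ ν w ω.2 s → 1 / 4 ≤ overlap ω.1 s}ᶜ ⊆ _)).trans
      ((prob_union_le H {ω | ¬ Discrepancy (a / n) ω.2} _).trans (add_le_add h1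
        ((prob_union_le H {ω | ¬ LightBound (a / n) (b / n) μ ν w r ω} _).trans
          (add_le_add h2 ((prob_union_le H _ _).trans (add_le_add h3 h4))))))
    · simp only [δ]
      linarith
    · intro ω hω
      by_contra hgood
      simp only [Set.mem_union, Set.mem_ofPred_eq, not_or, not_not, not_and, not_lt] at hgood
      obtain ⟨hX, hlight, hhigh, hbal⟩ := hgood
      refine hω fun s ⟨x, hx, hxs⟩ => ?_
      have hxnorm : ∑ u, x u ^ 2 = 1 := by
        rw [← EuclideanSpace.real_norm_sq_eq, hx.1, one_pow]
      have hD := abs_mul_one_sub_le_of_isTopVector hn (σ := ω.1) (fun y hy =>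
        abs_quadForm_centeredMatrix_sub_le hn (by linarith) hba.le han hμ hν hw' hh1 hX hlight
          (hhigh hbal) y hy.le) hx
      -- With E = 7370r, |β|(1 - T) ≤ 2E and |β| > 16E force 1 - T < 1/8, so the overlap is at least
      -- 3/8.
      have := overlap_ge_of_isSignVector hn (σ := ω.1) hxs hxnorm (δ := 1 / 8) (by
        by_contra hlt
        rw [not_le] at hlt
        have h5 : 1 / 8 < 1 - (∑ u, ((ω.1 u : ℤ) : ℝ) * x u) ^ 2 / n := by linarith
        have h6 := mul_lt_mul_of_pos_left h5 (by linarith : 0 < |beta a b μ ν w|)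
        linarith)
      linarith
  have hup : ∀ᶠ n : ℕ in Filter.atTop, prob (n := n) (a / (n : ℝ)) (b / (n : ℝ)) μ ν
      {ω | ∀ s, IsSpectralOutput a b μ ν w ω.2 s → 1 / 4 ≤ overlap ω.1 s} ≤ 1 := by
    filter_upwards [Filter.eventually_ge_atTop 1, Filter.eventually_ge_atTop ⌈a⌉₊] with n hn han
    have H := hadm n hn ((Nat.le_ceil a).trans (by exact_mod_cast han))
    rw [← prob_univ (n := n) H]
    exact prob_mono H (Set.subset_univ _)
  have hδ : Filter.Tendsto (fun n => 1 - δ n) Filter.atTop (nhds 1) := by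
    have he : Filter.Tendsto (fun n : ℕ => Real.exp (-(n : ℝ))) Filter.atTop (nhds 0) :=
      Real.tendsto_exp_neg_atTop_nhds_zero.comp tendsto_natCast_atTop_atTop
    have he2 : Filter.Tendsto (fun n : ℕ => Real.exp (-((n : ℝ) / 200))) Filter.atTop (nhds 0) :=
      Real.tendsto_exp_neg_atTop_nhds_zero.comp
        (tendsto_natCast_atTop_atTop.atTop_div_const (by norm_num))
    have hinv : Filter.Tendsto (fun n : ℕ => 1 / (n : ℝ)) Filter.atTop (nhds 0) :=
      tendsto_one_div_atTop_nhds_zero_nat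
    have := tendsto_const_nhds (x := (1 : ℝ)) (f := Filter.atTop (α := ℕ)) |>.sub
      (hinv.add ((he.const_mul 2).add (he.add (he2.const_mul 2))))
    simpa [δ] using this
  exact tendsto_of_tendsto_of_tendsto_of_le_of_le' hδ tendsto_const_nhds hlow hup

theorem beta_optWeight (hb : 0 < b) (hba : b < a) (μ ν : L → ℝ) :
    beta a b μ ν (optWeight a b μ ν) = tau a b μ ν := by
  have hab : a + b ≠ 0 := by linarith
  rw [beta, tau, mul_sum, mul_sum]
  refine sum_congr rfl fun ℓ _ => ?_
  rw [optWeight]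
  -- At a label that never occurs both summands vanish, by the convention x/0 = 0.
  by_cases h : a * μ ℓ + b * ν ℓ = 0
  · simp [h]
  · field_simp

theorem tau_nonneg (hb : 0 < b) (hba : b < a) (hμ : μ ∈ stdSimplex ℝ L)
    (hν : ν ∈ stdSimplex ℝ L) : 0 ≤ tau a b μ ν := by
  have ha : 0 < a := hb.trans hba
  refine mul_nonneg (by positivity) (sum_nonneg fun ℓ _ => ?_)
  have h1 := hμ.1 ℓ
  have h2 := hν.1 ℓ
  positivity

theorem optWeight_mem_Icc (hb : 0 < b) (hba : b < a) (hμ : μ ∈ stdSimplex ℝ L)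
    (hν : ν ∈ stdSimplex ℝ L) (ℓ : L) : optWeight a b μ ν ℓ ∈ Set.Icc (-1 : ℝ) 1 := by
  have h1 : 0 ≤ a * μ ℓ := mul_nonneg (hb.trans hba).le (hμ.1 ℓ)
  have h2 : 0 ≤ b * ν ℓ := mul_nonneg hb.le (hν.1 ℓ)
  rw [Set.mem_Icc, ← abs_le, optWeight, abs_div, abs_of_nonneg (add_nonneg h1 h2)]
  refine div_le_one_of_le₀ ?_ (add_nonneg h1 h2)
  rw [abs_le]
  constructor <;> linarith

end Main

end LabeledSBM

end

theorem mainTheorem5 :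
    ∃ C₀ C : ℝ, 0 < C₀ ∧ 0 < C ∧
      ∀ (L : Type) [Fintype L] (a b : ℝ) (μ ν : L → ℝ),
        C₀ < b → b < a → μ ∈ stdSimplex ℝ L → ν ∈ stdSimplex ℝ L →
          (∀ w : L → ℝ, (∀ ℓ, w ℓ ∈ Set.Icc (-1 : ℝ) 1) →
            C * (a + b) < LabeledSBM.beta a b μ ν w ^ 2 →
              LabeledSBM.SpectralSucceeds a b μ ν w) ∧
          (C * (a + b) < LabeledSBM.beta a b μ ν (LabeledSBM.optWeight a b μ ν) ^ 2 ↔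
            Real.sqrt (C * (a + b)) < LabeledSBM.tau a b μ ν) ∧
          (Real.sqrt (C * (a + b)) < LabeledSBM.tau a b μ ν →
            LabeledSBM.SpectralSucceeds a b μ ν (LabeledSBM.optWeight a b μ ν)) := by
  -- The bound b > 1 serves to make d ≥ 1, so that a power of two at least 1 can be comparable to
  -- √d.
  refine ⟨1, 2 * (16 * 7370) ^ 2, one_pos, by norm_num, ?_⟩
  intro L _ a b μ ν hb hba hμ hν
  have hb0 : 0 < b := one_pos.trans hb
  have hiff : 2 * (16 * 7370) ^ 2 * (a + b) <
      LabeledSBM.beta a b μ ν (LabeledSBM.optWeight a b μ ν) ^ 2 ↔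
      Real.sqrt (2 * (16 * 7370) ^ 2 * (a + b)) < LabeledSBM.tau a b μ ν := by
    rw [LabeledSBM.beta_optWeight hb0 hba,
      Real.sqrt_lt (mul_nonneg (by norm_num) (by linarith)) (LabeledSBM.tau_nonneg hb0 hba hμ hν)]
  refine ⟨fun w hw hβ => LabeledSBM.spectralSucceeds_of_lt hb hba hμ hν hw hβ, hiff, fun hτ => ?_⟩
  exact LabeledSBM.spectralSucceeds_of_lt hb hba hμ hν
    (LabeledSBM.optWeight_mem_Icc hb0 hba hμ hν) (hiff.2 hτ)
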